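/- Let $G$ be a connected three-dimensional Lie group with a left-invariant Riemannian metric $g_G$, and let $\{e_1,e_2,e_3\}$ be an orthonormal basis of its Lie algebra with $$[e_1,e_2]=\alpha e_2+\beta e_3,\qquad [e_1,e_3]=-\beta e_2+\delta e_3,\qquad [e_2,e_3]=0,\qquad \alpha+\delta>0,\quad \alpha\ge\delta .$$ (By Milnor, every left-invariant metric on a non-unimodular three-dimensional Lie group admits such a basis.) Let $I\subset\mathbb R$ be a non-empty open interval, $f:I\to\,]0,+\infty[$ and $\phi:I\to\mathbb R$ smooth functions, and let $I\times_fG$ be the warped product, i.e. $I\times G$ with the metric $dt^2+f(t)^2g_G$. Let $V=\phi(t)\partial_t+V_2$, where $V_2=ae_1+be_2+ce_3$ is a left-invariant vector field on $G$ with $a^2+b^2+c^2=1$. A smooth vector field $V$ on a Riemannian manifold is called harmonic if $$\nabla^*\nabla V=\sum_i\left(\nabla_{\nabla_{E_i}E_i}V-\nabla_{E_i}\nabla_{E_i}V\right)=0,$$ where $\nabla$ is the Levi-Civita connection and $(E_i)$ is any local orthonormal frame. Then $V$ is a harmonic vector field on $I\times_fG$ if and only if there is $\epsilon\in\mathbb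 R$ such that $f$ satisfies on $I$ $$ff''+2f'^2=\epsilon ,$$ $\phi$ satisfies on $I$ $$\phi''+3\frac{f'}{f}\phi'-3\left(\frac{f'}{f}\right)^2\phi=-2a(\alpha+\delta)\frac{f'}{f},$$ and one of the following conditions holds: 1. $\alpha=\delta>0$ and one of (a) $\epsilon=2\alpha^2$ and $V_2=\pm e_1$; (b) $\beta=0$, $\epsilon=\alpha^2$ and $V_2=\pm e_2$ or $V_2=\pm e_3$; (c) $\beta=0$, $\epsilon=\alpha^2+\beta^2$ and $V_2=be_2+ce_3$ with $b^2+c^2=1$, $b\ne0$, $c\ne0$; 2. $\alpha>\delta>0$ or $\alpha>0>\delta$, and one of (a) $\epsilon=\alpha^2+\delta^2$, $V_2=ae_1+be_2+ce_3$ with $a\neq0$, $a^2+b^2+c^2=1$, $b(\beta^2-\delta^2)=\beta(\alpha+\delta)c$ and $c(\beta^2-\alpha^2)=-\beta(\alpha+\delta)b$; (b) $\beta=0$, $\epsilon=\delta^2$ and $V_2=\pm e_3$; (c) $\beta=0$, $\epsilon=\alpha^2$ and $V_2=\pm e_2$; (d) $\beta=bc(\alpha-\delta)$, $\epsilon=\beta^2+b^2\alpha^2+c^2\delta^2$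 and $V_2=be_2+ce_3$ with $b\ne0$, $c\neq0$, $b^2+c^2=1$; 3. $\alpha>\delta=0$ and one of (a) $\beta=0$, $\epsilon=0$, in which case $f(t)=(c_1t+c_2)^{1/3}$ on $I$ for some constants $c_1,c_2\in\mathbb R$ with $c_1t+c_2>0$ on $I$, and $V_2=\pm e_3$; (b) $\beta=0$, $\epsilon=\alpha^2$ and $V_2=\pm e_2$; (c) $\beta=bc\alpha$, $\epsilon=\beta^2+b^2\alpha^2$ and $V_2=be_2+ce_3$ with $b\ne0$, $c\ne0$, $b^2+c^2=1$; (d) $\epsilon=\alpha^2$ and $V_2=\pm e_1$; (e) $\beta=0$, $\epsilon=\alpha^2$ and $V_2=ae_1+be_2$ with $a\ne0$, $a^2+b^2=1$. -/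

import Mathlib

open scoped Manifold ContDiff

noncomputable section

section RiemannianGeometry

variable {E : Type*} [NormedAddCommGroup E] [NormedSpace ℝ E]
  {H : Type*} [TopologicalSpace H] (I : ModelWithCorners ℝ E H)
  {M : Type*} [TopologicalSpace M] [ChartedSpace H M] [IsManifold I 1 M]

/-- A (0,2)-tensor field on `M`, not assumed to be continuous: a form on each tangent space. -/
abbrev MetricField (M : Type*) [TopologicalSpace M] [ChartedSpace H M] : Type _ :=
  ∀ p : M, TangentSpace I p → TangentSpace I p → ℝ

/-- `cov` is the Levi-Civita connection of the metric `g` on the open set `Ω` of `M`: a covariant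
derivative on the tangent bundle over `Ω` that is torsion free and compatible with `g`.
As in Mathlib, `cov Y p v` is the derivative `(∇_v Y)(p)`, for a tangent vector `v` at `p`. -/
structure IsLeviCivitaOn (g : MetricField I M) (Ω : Set M)
    (cov : (∀ p : M, TangentSpace I p) → ∀ p : M, TangentSpace I p →L[ℝ] TangentSpace I p) :
    Prop where
  isCovariantDerivativeOn : IsCovariantDerivativeOn E cov Ω
  torsion_free : ∀ p ∈ Ω, ∀ X Y : (∀ q : M, TangentSpace I q),
    MDiffAt (T% X) p → MDiffAt (T% Y) p →
      cov Y p (X p) - cov X p (Y p) = VectorField.mlieBracket I X Y p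
  metric_compatible : ∀ p ∈ Ω, ∀ X Y : (∀ q : M, TangentSpace I q),
    MDiffAt (T% X) p → MDiffAt (T% Y) p → ∀ v : TangentSpace I p,
      mvfderiv I (fun q ↦ g q (X q) (Y q)) p v = g p (cov X p v) (Y p) + g p (X p) (cov Y p v)

/-- `e` is a smooth orthonormal frame field of `(M, g)` on the set `N`. -/
structure IsOrthonormalFrameOn (g : MetricField I M) (N : Set M)
    (e : Fin (Module.finrank ℝ E) → ∀ p : M, TangentSpace I p) : Prop where
  smooth : ∀ i, CMDiff[N] ∞ (T% (e i))
  orthonormal : ∀ p ∈ N, ∀ i j, g p (e i p) (e j p) = if i = j then 1 else 0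

/-- The rough Laplacian `∇*∇V = ∑ᵢ (∇_{∇_{eᵢ} eᵢ} V - ∇_{eᵢ} ∇_{eᵢ} V)` at the point `p`, written in
the frame field `e`. -/
def roughLaplacian (cov : (∀ p : M, TangentSpace I p) →
      ∀ p : M, TangentSpace I p →L[ℝ] TangentSpace I p)
    (e : Fin (Module.finrank ℝ E) → ∀ p : M, TangentSpace I p)
    (V : ∀ p : M, TangentSpace I p) (p : M) : TangentSpace I p :=
  ∑ i, (cov V p (cov (e i) p (e i p)) - cov (fun q ↦ cov V q (e i q)) p (e i p))

/-- `V` is a harmonic vector field of `(Ω, g)`, for an open set `Ω` of `M`: it is smooth on `Ω` and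
its rough Laplacian for the Levi-Civita connection of `g`, computed in local orthonormal frame
fields, vanishes on `Ω`. -/
def IsHarmonicVectorFieldOn (g : MetricField I M) (Ω : Set M)
    (V : ∀ p : M, TangentSpace I p) : Prop :=
  CMDiff[Ω] ∞ (T% V) ∧
  ∃ cov : (∀ p : M, TangentSpace I p) → ∀ p : M, TangentSpace I p →L[ℝ] TangentSpace I p,
    IsLeviCivitaOn I g Ω cov ∧
    ∀ N ⊆ Ω, IsOpen N → ∀ e : Fin (Module.finrank ℝ E) → (∀ p : M, TangentSpace I p),
      IsOrthonormalFrameOn I g N e → ∀ p ∈ N, roughLaplacian I cov e V p = 0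

end RiemannianGeometry

section WarpedProduct

variable {G : Type*} [TopologicalSpace G] [ChartedSpace (EuclideanSpace ℝ (Fin 3)) G]

/-- A smooth Riemannian metric on the three-dimensional manifold `G`. -/
abbrev SmoothMetric (G : Type*) [TopologicalSpace G]
    [ChartedSpace (EuclideanSpace ℝ (Fin 3)) G] [IsManifold (𝓡 3) 1 G] : Type _ :=
  Bundle.ContMDiffRiemannianMetric (𝓡 3) ∞ (EuclideanSpace ℝ (Fin 3))
    (fun x : G ↦ TangentSpace (𝓡 3) x)

/-- The metric on the Lie group `G` is invariant under all left translations. -/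
def SmoothMetric.IsLeftInvariant [Group G] [IsManifold (𝓡 3) 1 G] (gG : SmoothMetric G) : Prop :=
  ∀ (h x : G) (v w : TangentSpace (𝓡 3) x),
    gG.inner (h * x) (mfderiv (𝓡 3) (𝓡 3) (fun y ↦ h * y) x v)
      (mfderiv (𝓡 3) (𝓡 3) (fun y ↦ h * y) x w) = gG.inner x v w

/-- The warped product metric `π^*(dt²) + (f ∘ π)² σ^*(g_G)` on `ℝ × G`, where `π` and `σ` are the
two projections. Where `f` is positive and smooth it is a Riemannian metric. -/
def warpedMetric [IsManifold (𝓡 3) 1 G] (f : ℝ → ℝ) (gG : SmoothMetric G) :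
    MetricField (𝓘(ℝ, ℝ).prod (𝓡 3)) (ℝ × G) :=
  fun p v w ↦
    mvfderiv (𝓘(ℝ, ℝ).prod (𝓡 3)) Prod.fst p v * mvfderiv (𝓘(ℝ, ℝ).prod (𝓡 3)) Prod.fst p w +
      f p.1 ^ 2 * gG.inner p.2 (mfderiv (𝓘(ℝ, ℝ).prod (𝓡 3)) (𝓡 3) Prod.snd p v)
        (mfderiv (𝓘(ℝ, ℝ).prod (𝓡 3)) (𝓡 3) Prod.snd p w)

/-- The vector field `φ(t) ∂ₜ + V₂` on `ℝ × G`, where `V₂` is the left-invariant vector field with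
value `v` at the identity; a tangent vector of `ℝ × G` is a pair of tangent vectors. -/
def warpedField [Group G] (φ : ℝ → ℝ) (v : GroupLieAlgebra (𝓡 3) G) :
    ∀ p : ℝ × G, TangentSpace (𝓘(ℝ, ℝ).prod (𝓡 3)) p :=
  fun p ↦ ((φ p.1, mulInvariantVectorField v p.2) : ℝ × TangentSpace (𝓡 3) p.2)

end WarpedProduct

end

/-! The fields ∂ₜ, e₁, e₂, e₃ form a global frame of `ℝ × G`. Left unnormalised, it keeps the
constant structure coefficients of the Lie algebra, and the metric is diagonal with entries 1, f²,
f², f². The Christoffel symbols and the components of V depend on t alone, so ∇*∇V is computed in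
one variable. The result, `warpedLaplacian`, splits: its ∂ₜ-component is minus the equation for φ,
and its G-components are f⁻²(LV₂ - (ff'' + 2f'²)V₂), where L is the rough Laplacian of g_G on
left-invariant fields. Since V₂ is a constant unit vector, vanishing forces ff'' + 2f'² to be a
constant ε with LV₂ = εV₂ (`forall_warpedLaplacian_eq_zero_iff`).

The rest is linear algebra. L multiplies e₁ by α² + δ² and acts on the span of e₂, e₃ as diag(β² +
α², β² + δ²) plus β(α + δ) times the rotation by a right angle. Eliminating ε there leaves (b² +
c²)β = bc(α - δ). The list of cases follows by distinguishing whether a = 0 and whether α = δ or δ =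
0 (`isLaplacianEigenvector_iff`).

Harmonicity refers to some Levi-Civita connection and to all local orthonormal frames. Computing in
the fixed frame is legitimate because the connection exists (`isLeviCivitaOn_frameConnection`), is
unique on differentiable fields (`IsLeviCivitaOn.eq`), and yields a Laplacian independent of the
frame (`roughLaplacian_eq`). -/

noncomputable section

/-! ### Connections, diagonal metrics and the rough Laplacian in a global frame. -/

section Frame

open VectorField

variable {E : Type*} [NormedAddCommGroup E] [NormedSpace ℝ E]
  {H : Type*} [TopologicalSpace H] {I : ModelWithCorners ℝ E H}
  {M : Type*} [TopologicalSpace M] [ChartedSpace H M]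
  {ι : Type} [Fintype ι]

/-- `X` is a global differentiable frame field of `M` with dual coframe `θ`; the components of a
differentiable vector field in this frame are differentiable. -/
structure IsDualFrame [DecidableEq ι] [IsManifold I 1 M] (X : ι → ∀ p : M, TangentSpace I p)
    (θ : ι → ∀ p : M, TangentSpace I p →L[ℝ] ℝ) : Prop where
  mdifferentiableAt : ∀ i p, MDiffAt (T% (X i)) p
  mdifferentiableAt_coframe : ∀ i p (Y : ∀ q : M, TangentSpace I q), MDiffAt (T% Y) p →
    MDiffAt (fun q ↦ θ i q (Y q)) p
  coframe_apply : ∀ p i j, θ i p (X j p) = if i = j then 1 else 0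
  sum_smul : ∀ p v, ∑ i, θ i p v • X i p = v

/-- The connection whose covariant differentials of the frame fields `X j` are `D j`. -/
def frameConnection (X : ι → ∀ p : M, TangentSpace I p)
    (θ : ι → ∀ p : M, TangentSpace I p →L[ℝ] ℝ)
    (D : ι → ∀ p : M, TangentSpace I p →L[ℝ] TangentSpace I p)
    (Y : ∀ p : M, TangentSpace I p) (p : M) : TangentSpace I p →L[ℝ] TangentSpace I p :=
  ∑ j, ((mvfderiv I (fun q ↦ θ j q (Y q)) p).smulRight (X j p) + θ j p (Y p) • D j p)

/-- The metric which is diagonal in the coframe `θ`, with diagonal entries `m`. -/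
def diagonalMetric (θ : ι → ∀ p : M, TangentSpace I p →L[ℝ] ℝ) (m : ι → M → ℝ) :
    MetricField I M :=
  fun p v w ↦ ∑ i, m i p * (θ i p v * θ i p w)

variable {X : ι → ∀ p : M, TangentSpace I p} {θ : ι → ∀ p : M, TangentSpace I p →L[ℝ] ℝ}
  {D : ι → ∀ p : M, TangentSpace I p →L[ℝ] TangentSpace I p} {m : ι → M → ℝ}

theorem diagonalMetric_comm (p : M) (v w : TangentSpace I p) :
    diagonalMetric θ m p v w = diagonalMetric θ m p w v := by
  simp only [diagonalMetric, mul_comm]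

theorem diagonalMetric_add_left (p : M) (v v' w : TangentSpace I p) :
    diagonalMetric θ m p (v + v') w = diagonalMetric θ m p v w + diagonalMetric θ m p v' w := by
  simp only [diagonalMetric, map_add, ← Finset.sum_add_distrib]
  exact Finset.sum_congr rfl fun i _ ↦ by ring

theorem diagonalMetric_smul_left (p : M) (r : ℝ) (v w : TangentSpace I p) :
    diagonalMetric θ m p (r • v) w = r * diagonalMetric θ m p v w := by
  simp only [diagonalMetric, map_smul, smul_eq_mul, Finset.mul_sum]
  exact Finset.sum_congr rfl fun i _ ↦ by ring

variable [DecidableEq ι]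

/-- The sum of eₐ ⊗ eₐ over an orthonormal basis is the inverse metric. Orthonormality says that a
matrix has a right inverse; as the index types have equal cardinality, this is also a left inverse.
-/
theorem sum_coframe_mul_coframe {n : ℕ} (hn : Fintype.card ι = n) {p : M}
    {e : Fin n → TangentSpace I p}
    (he : ∀ a b, diagonalMetric θ m p (e a) (e b) = if a = b then 1 else 0) (hm : ∀ i, m i p ≠ 0)
    (i j : ι) : ∑ a, θ i p (e a) * θ j p (e a) = if i = j then (m i p)⁻¹ else 0 := by
  let U : Matrix (Fin n) ι ℝ := Matrix.of fun a i ↦ θ i p (e a)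
  let W : Matrix ι (Fin n) ℝ := Matrix.of fun i a ↦ m i p * θ i p (e a)
  have h1 : U * W = 1 := by
    ext a b
    simp only [U, W, Matrix.mul_apply, Matrix.of_apply, Matrix.one_apply, ← he, diagonalMetric]
    exact Finset.sum_congr rfl fun i _ ↦ by ring
  have h2 : W * U = 1 :=
    (Matrix.mul_eq_one_comm_of_equiv (Fintype.equivFinOfCardEq hn).symm).1 h1
  have h3 := congrFun (congrFun h2 i) j
  simp only [U, W, Matrix.mul_apply, Matrix.of_apply, Matrix.one_apply, mul_assoc,
    ← Finset.mul_sum] at h3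
  rw [eq_div_of_mul_eq (hm i) ((mul_comm _ _).trans h3)]
  split_ifs <;> simp

variable [IsManifold I 1 M]

namespace IsDualFrame

theorem frameConnection_self (h : IsDualFrame X θ) (j : ι) (p : M) :
    frameConnection X θ D (X j) p = D j p := by
  have h0 : ∀ i, mvfderiv I (fun q ↦ θ i q (X j q)) p = 0 := by
    intro i
    simp only [h.coframe_apply]
    exact mvfderiv_const _
  ext v
  simp only [frameConnection, h0, sum_apply, add_apply, ContinuousLinearMap.smulRight_apply,
    smul_apply]
  simp [h.coframe_apply]

theorem isCovariantDerivativeOn_frameConnection (h : IsDualFrame X θ) (s : Set M) :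
    IsCovariantDerivativeOn E (frameConnection X θ D) s where
  add {Y Z p} hY hZ _ := by
    have key : ∀ j, mvfderiv I (fun q ↦ θ j q (Y q) + θ j q (Z q)) p =
        mvfderiv I (fun q ↦ θ j q (Y q)) p + mvfderiv I (fun q ↦ θ j q (Z q)) p :=
      fun j ↦ mvfderiv_fun_add (h.mdifferentiableAt_coframe j p Y hY)
        (h.mdifferentiableAt_coframe j p Z hZ)
    ext v
    simp only [frameConnection, key, sum_apply, add_apply,
      ContinuousLinearMap.smulRight_apply, smul_apply, Pi.add_apply, map_add,
      ← Finset.sum_add_distrib]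
    refine Finset.sum_congr rfl fun j _ ↦ ?_
    module
  leibniz {Y g p} hY hg _ := by
    have key : ∀ j, mvfderiv I (fun q ↦ g q * θ j q (Y q)) p =
        g p • mvfderiv I (fun q ↦ θ j q (Y q)) p + θ j p (Y p) • mvfderiv I g p :=
      fun j ↦ mvfderiv_fun_mul hg (h.mdifferentiableAt_coframe j p Y hY)
    ext v
    simp only [frameConnection, key, sum_apply, add_apply,
      ContinuousLinearMap.smulRight_apply, smul_apply, Pi.smul_apply', map_smul,
      smul_eq_mul]
    -- The Leibniz terms of the separate components reassemble into `Y p` by the coframe expansion.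
    have hY' : mvfderiv I g p v • Y p = ∑ j, mvfderiv I g p v • θ j p (Y p) • X j p := by
      rw [← Finset.smul_sum, h.sum_smul]
    rw [hY', Finset.smul_sum, ← Finset.sum_add_distrib]
    refine Finset.sum_congr rfl fun j _ ↦ ?_
    module

/-- This reduces each tensorial identity below to a check on the frame fields. -/
theorem tensorialAt_eq_sum {A : Type*} [AddCommGroup A] [Module ℝ A] (h : IsDualFrame X θ)
    {Φ : (∀ p : M, TangentSpace I p) → A} {p : M} (hΦ : TensorialAt I E Φ p)
    {Y : ∀ p : M, TangentSpace I p} (hY : MDiffAt (T% Y) p) :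
    Φ Y = ∑ i, θ i p (Y p) • Φ (X i) := by
  have hc : ∀ i, MDiffAt (fun q ↦ θ i q (Y q)) p :=
    fun i ↦ h.mdifferentiableAt_coframe i p Y hY
  have hYs : Y = fun q ↦ ∑ i, ((fun q ↦ θ i q (Y q)) • X i) q := by
    ext1 q
    exact (h.sum_smul q (Y q)).symm
  conv_lhs => rw [hYs]
  rw [hΦ.sum (fun i ↦ (fun q ↦ θ i q (Y q)) • X i)
    fun i _ ↦ (hc i).smul_section (h.mdifferentiableAt i p)]
  exact Finset.sum_congr rfl fun i _ ↦ hΦ.smul (hc i) (h.mdifferentiableAt i p)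

theorem tensorialAt_eq_zero {A : Type*} [AddCommGroup A] [Module ℝ A] (h : IsDualFrame X θ)
    {Φ : (∀ p : M, TangentSpace I p) → A} {p : M} (hΦ : TensorialAt I E Φ p)
    (hX : ∀ i, Φ (X i) = 0) {Y : ∀ p : M, TangentSpace I p} (hY : MDiffAt (T% Y) p) :
    Φ Y = 0 := by
  simp [h.tensorialAt_eq_sum hΦ hY, hX]

theorem mdifferentiableAt_diagonalMetric (h : IsDualFrame X θ) {p : M}
    (hm : ∀ i, MDiffAt (m i) p) {Y Z : ∀ p : M, TangentSpace I p} (hY : MDiffAt (T% Y) p)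
    (hZ : MDiffAt (T% Z) p) : MDiffAt (fun q ↦ diagonalMetric θ m q (Y q) (Z q)) p := by
  have hmul : ∀ i, MDiffAt (m i * ((fun q ↦ θ i q (Y q)) * fun q ↦ θ i q (Z q))) p := fun i ↦
    (hm i).mul ((h.mdifferentiableAt_coframe i p Y hY).mul (h.mdifferentiableAt_coframe i p Z hZ))
  have key : (fun q ↦ diagonalMetric θ m q (Y q) (Z q)) =
      ∑ i, m i * ((fun q ↦ θ i q (Y q)) * fun q ↦ θ i q (Z q)) := by
    ext q
    simp [diagonalMetric]
  rw [key]
  exact MDifferentiableAt.sum fun i _ ↦ hmul i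

theorem diagonalMetric_apply_frame (h : IsDualFrame X θ) (p : M) (v : TangentSpace I p) (j : ι) :
    diagonalMetric θ m p v (X j p) = m j p * θ j p v := by
  simp [diagonalMetric, h.coframe_apply]

/-- In the defect of metric compatibility the derivative of the scalar factor appears twice, once
from the product rule and once from the Leibniz rule of `cov`, and cancels. The other slot follows
by symmetry of the metric. -/
theorem tensorialAt_metric (h : IsDualFrame X θ) {cov : (∀ p : M, TangentSpace I p) →
      ∀ p : M, TangentSpace I p →L[ℝ] TangentSpace I p} {Ω : Set M}
    (hcov : IsCovariantDerivativeOn E cov Ω) {p : M} (hp : p ∈ Ω)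
    (hm : ∀ i, MDiffAt (m i) p) (v : TangentSpace I p)
    {Z : ∀ p : M, TangentSpace I p} (hZ : MDiffAt (T% Z) p) :
    TensorialAt I E (fun Y ↦ mvfderiv I (fun q ↦ diagonalMetric θ m q (Y q) (Z q)) p v -
      (diagonalMetric θ m p (cov Y p v) (Z p) + diagonalMetric θ m p (Y p) (cov Z p v))) p where
  smul {g Y} hg hY := by
    simp only [Pi.smul_apply', diagonalMetric_smul_left, hcov.leibniz hY hg hp, add_apply,
      smul_apply, ContinuousLinearMap.smulRight_apply, diagonalMetric_add_left, smul_eq_mul,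
      mvfderiv_fun_mul hg (h.mdifferentiableAt_diagonalMetric hm hY hZ)]
    ring
  add {Y Y'} hY hY' := by
    simp only [Pi.add_apply, diagonalMetric_add_left, hcov.add hY hY' hp, add_apply,
      mvfderiv_fun_add (h.mdifferentiableAt_diagonalMetric hm hY hZ)
        (h.mdifferentiableAt_diagonalMetric hm hY' hZ)]
    ring

theorem isLeviCivitaOn_frameConnection [IsManifold I 2 M] [CompleteSpace E]
    (h : IsDualFrame X θ) {Ω : Set M}
    (hm : ∀ i, ∀ p ∈ Ω, MDiffAt (m i) p)
    (htorsion : ∀ p ∈ Ω, ∀ i j, D j p (X i p) - D i p (X j p) = mlieBracket I (X i) (X j) p)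
    (hmetric : ∀ p ∈ Ω, ∀ i j k, (if i = j then mvfderiv I (m i) p (X k p) else 0) =
      m j p * θ j p (D i p (X k p)) + m i p * θ i p (D j p (X k p))) :
    IsLeviCivitaOn I (diagonalMetric θ m) Ω (frameConnection X θ D) where
  isCovariantDerivativeOn := h.isCovariantDerivativeOn_frameConnection Ω
  torsion_free := by
    intro p hp Y Z hY hZ
    have hcov := h.isCovariantDerivativeOn_frameConnection (D := D) Ω
    set cov := frameConnection X θ D with hc
    have h1 : ∀ Z, TensorialAt I E
        (fun Y ↦ cov Z p (Y p) - cov Y p (Z p) - mlieBracket I Y Z p) p := fun Z ↦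
      { smul := fun {g Y} hg hY ↦ by
          simp only [hcov.leibniz hY hg hp, mlieBracket_smul_left hg hY, add_apply, smul_apply,
            ContinuousLinearMap.smulRight_apply, Pi.smul_apply', map_smul]
          module
        add := fun {Y Y'} hY hY' ↦ by
          simp only [hcov.add hY hY' hp, mlieBracket_add_left hY hY', add_apply, Pi.add_apply,
            map_add]
          module }
    have h2 : ∀ Y, TensorialAt I E
        (fun Z ↦ cov Z p (Y p) - cov Y p (Z p) - mlieBracket I Y Z p) p := fun Z ↦
      { smul := fun {g Y} hg hY ↦ by
          simp only [hcov.leibniz hY hg hp, mlieBracket_smul_right hg hY, add_apply, smul_apply,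
            ContinuousLinearMap.smulRight_apply, Pi.smul_apply', map_smul]
          module
        add := fun {Y Y'} hY hY' ↦ by
          simp only [hcov.add hY hY' hp, mlieBracket_add_right hY hY', add_apply, Pi.add_apply,
            map_add]
          module }
    -- The torsion is tensorial in each slot, so both arguments may be replaced by frame fields.
    refine sub_eq_zero.1 (h.tensorialAt_eq_zero (h1 Z) (fun i ↦ ?_) hY)
    refine h.tensorialAt_eq_zero (h2 (X i)) (fun j ↦ ?_) hZ
    rw [hc, h.frameConnection_self, h.frameConnection_self, htorsion p hp, sub_self]
  metric_compatible := by
    intro p hp Y Z hY hZ v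
    have hcov := h.isCovariantDerivativeOn_frameConnection (D := D) Ω
    have hmp : ∀ i, MDiffAt (m i) p := fun i ↦ hm i p hp
    have hframe : ∀ i j, mvfderiv I (fun q ↦ diagonalMetric θ m q (X j q) (X i q)) p v =
        diagonalMetric θ m p (frameConnection X θ D (X j) p v) (X i p) +
          diagonalMetric θ m p (X j p) (frameConnection X θ D (X i) p v) := by
      intro i j
      simp only [diagonalMetric_comm (θ := θ) (m := m) p (X j p), h.diagonalMetric_apply_frame,
        h.frameConnection_self, h.coframe_apply]
      have hj : ∀ k, (if i = j then mvfderiv I (m i) p (X k p) else 0) =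
          m i p * θ i p (D j p (X k p)) + m j p * θ j p (D i p (X k p)) := by
        intro k
        rw [hmetric p hp i j k, add_comm]
      have hd : ∀ v, mvfderiv I (fun q ↦ m i q * if i = j then (1 : ℝ) else 0) p v =
          if i = j then mvfderiv I (m i) p v else 0 := by
        intro v
        split_ifs
        · simp
        · simp only [mul_zero]
          rw [mvfderiv_const]
          rfl
      rw [hd]
      have hv := h.sum_smul p v
      rw [← hv]
      simp only [map_sum, map_smul, smul_eq_mul, Finset.mul_sum, ← Finset.sum_add_distrib]
      have : ∀ k, θ k p v * (if i = j then mvfderiv I (m i) p (X k p) else 0) =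
          m i p * (θ k p v * θ i p (D j p (X k p))) + m j p * (θ k p v * θ j p (D i p (X k p))) := by
        intro k
        rw [hj]
        ring
      rw [← Finset.sum_congr rfl fun k _ ↦ this k]
      split_ifs <;> simp
    refine sub_eq_zero.1 (h.tensorialAt_eq_zero
      (h.tensorialAt_metric hcov hp hmp v hZ) (fun i ↦ sub_eq_zero.2 ?_) hY)
    have h3 := sub_eq_zero.1 (h.tensorialAt_eq_zero
      (h.tensorialAt_metric hcov hp hmp v (h.mdifferentiableAt i p))
      (fun j ↦ sub_eq_zero.2 (hframe i j)) hZ)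
    simp only [diagonalMetric_comm (θ := θ) (m := m) _ (Z _)] at h3
    rw [h3, diagonalMetric_comm p (X i p), add_comm]

end IsDualFrame

/-- Let S be the difference of the two connections. S(Y, Z) is symmetric because both are torsion
free, and g(S(Y, Z), W) is skew in Z, W because both are metric. Alternating the two symmetries six
times returns the same term with the opposite sign, so it vanishes. Only nondegeneracy of the metric
is used. -/
theorem IsLeviCivitaOn.eq (h : IsDualFrame X θ) {Ω : Set M}
    {cov cov' : (∀ p : M, TangentSpace I p) → ∀ p : M, TangentSpace I p →L[ℝ] TangentSpace I p}
    (hcov : IsLeviCivitaOn I (diagonalMetric θ m) Ω cov)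
    (hcov' : IsLeviCivitaOn I (diagonalMetric θ m) Ω cov') {p : M} (hp : p ∈ Ω)
    (hm : ∀ i, m i p ≠ 0) {Y : ∀ p : M, TangentSpace I p} (hY : MDiffAt (T% Y) p) :
    cov Y p = cov' Y p := by
  have hsym : ∀ Y Z W : (∀ p : M, TangentSpace I p), MDiffAt (T% Y) p → MDiffAt (T% Z) p →
      diagonalMetric θ m p (cov Z p (Y p) - cov' Z p (Y p)) (W p) =
      diagonalMetric θ m p (cov Y p (Z p) - cov' Y p (Z p)) (W p) := by
    intro Y Z W hY hZ
    congr 1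
    have h1 := hcov.torsion_free p hp Y Z hY hZ
    rw [← hcov'.torsion_free p hp Y Z hY hZ] at h1
    rw [sub_eq_sub_iff_sub_eq_sub] at h1
    exact h1
  have hanti : ∀ Y Z W : (∀ p : M, TangentSpace I p), MDiffAt (T% Z) p → MDiffAt (T% W) p →
      diagonalMetric θ m p (cov Z p (Y p) - cov' Z p (Y p)) (W p) =
      -diagonalMetric θ m p (cov W p (Y p) - cov' W p (Y p)) (Z p) := by
    intro Y Z W hZ hW
    have h1 := hcov.metric_compatible p hp Z W hZ hW (Y p)
    rw [hcov'.metric_compatible p hp Z W hZ hW (Y p)] at h1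
    have hsub : ∀ u v w : TangentSpace I p, diagonalMetric θ m p (u - v) w =
        diagonalMetric θ m p u w - diagonalMetric θ m p v w := fun u v w ↦ by
      rw [eq_sub_iff_add_eq, ← diagonalMetric_add_left, sub_add_cancel]
    rw [hsub, hsub, diagonalMetric_comm p (cov W p (Y p)),
      diagonalMetric_comm p (cov' W p (Y p))]
    linarith
  have hzero : ∀ i j, θ j p (cov Y p (X i p) - cov' Y p (X i p)) = 0 := by
    intro i j
    have hi := h.mdifferentiableAt i p
    have hj := h.mdifferentiableAt j p
    have e1 := hanti (X i) Y (X j) hY hj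
    have e2 := hsym (X i) (X j) Y hi hj
    have e3 := hanti (X j) (X i) Y hi hY
    have e4 := hsym (X j) Y (X i) hj hY
    have e5 := hanti Y (X j) (X i) hj hi
    have e6 := hsym Y (X i) (X j) hY hi
    have e7 : diagonalMetric θ m p (cov Y p (X i p) - cov' Y p (X i p)) (X j p) = 0 := by
      linarith
    rw [h.diagonalMetric_apply_frame] at e7
    exact (mul_eq_zero.1 e7).resolve_left (hm j)
  have hX : ∀ i, cov Y p (X i p) = cov' Y p (X i p) := by
    intro i
    rw [← sub_eq_zero, ← h.sum_smul p (cov Y p (X i p) - cov' Y p (X i p))]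
    exact Finset.sum_eq_zero fun j _ ↦ by rw [hzero, zero_smul]
  ext v
  rw [← h.sum_smul p v]
  simp only [map_sum, map_smul, hX]

/-- The rough Laplacian does not depend on the orthonormal frame. -/
theorem IsDualFrame.roughLaplacian_eq (h : IsDualFrame X θ)
    (hn : Fintype.card ι = Module.finrank ℝ E) {N Ω : Set M}
    {cov : (∀ p : M, TangentSpace I p) → ∀ p : M, TangentSpace I p →L[ℝ] TangentSpace I p}
    (hcov : IsCovariantDerivativeOn E cov Ω)
    {e : Fin (Module.finrank ℝ E) → ∀ p : M, TangentSpace I p}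
    (he : IsOrthonormalFrameOn I (diagonalMetric θ m) N e) {p : M} (hpN : N ∈ nhds p)
    (hp : p ∈ Ω) (hm : ∀ i, m i p ≠ 0) {V : ∀ p : M, TangentSpace I p}
    (hV : ∀ i, MDiffAt (T% (fun q ↦ cov V q (X i q))) p) :
    roughLaplacian I cov e V p = ∑ i, (m i p)⁻¹ •
      (cov V p (cov (X i) p (X i p)) - cov (fun q ↦ cov V q (X i q)) p (X i p)) := by
  -- The Leibniz rule for ∇ᵥ∇_Y V needs ∇_Y V to be differentiable; this is inherited from the
  -- fields ∇_{Xᵢ} V.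
  have hVY : ∀ {Y : ∀ p : M, TangentSpace I p}, MDiffAt (T% Y) p →
      MDiffAt (T% (fun q ↦ cov V q (Y q))) p := by
    intro Y hY
    have hc : ∀ i, MDiffAt (fun q ↦ θ i q (Y q)) p :=
      fun i ↦ h.mdifferentiableAt_coframe i p Y hY
    refine (MDifferentiableAt.sum_section (s := Finset.univ)
      (t := fun i ↦ (fun q ↦ θ i q (Y q)) • fun q ↦ cov V q (X i q))
      fun i _ ↦ (hc i).smul_section (hV i)).congr_of_eventuallyEq (.of_forall fun q ↦ ?_)
    refine congrArg (Bundle.TotalSpace.mk' E q) ?_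
    conv_lhs => rw [← h.sum_smul q (Y q)]
    simp only [map_sum, map_smul, Pi.smul_apply']
  -- Up to sign this is the second covariant derivative of V: the derivatives of the scalar factor
  -- cancel between its two terms. The rough Laplacian is therefore the trace of a bilinear form.
  have hQ : ∀ v : TangentSpace I p, TensorialAt I E
      (fun Y ↦ cov V p (cov Y p v) - cov (fun q ↦ cov V q (Y q)) p v) p := fun v ↦
    { smul := fun {g Y} hg hY ↦ by
        have key : (fun q ↦ cov V q ((g • Y) q)) = g • fun q ↦ cov V q (Y q) := by
          ext1 q
          simp
        rw [key]
        simp only [hcov.leibniz hY hg hp, hcov.leibniz (hVY hY) hg hp, add_apply, smul_apply,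
          ContinuousLinearMap.smulRight_apply, map_add, map_smul]
        module
      add := fun {Y Y'} hY hY' ↦ by
        have key : (fun q ↦ cov V q ((Y + Y') q)) =
            (fun q ↦ cov V q (Y q)) + fun q ↦ cov V q (Y' q) := by
          ext1 q
          simp
        rw [key]
        simp only [hcov.add hY hY' hp, hcov.add (hVY hY) (hVY hY') hp, add_apply, map_add]
        module }
  have hpN' : p ∈ N := mem_of_mem_nhds hpN
  have hed : ∀ a, MDiffAt (T% (e a)) p := fun a ↦
    ((he.smooth a).contMDiffAt hpN).mdifferentiableAt (by simp)
  have hlin : ∀ (v : TangentSpace I p) (j : ι),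
      cov V p (cov (X j) p v) - cov (fun q ↦ cov V q (X j q)) p v = ∑ i, θ i p v •
        (cov V p (cov (X j) p (X i p)) - cov (fun q ↦ cov V q (X j q)) p (X i p)) := by
    intro v j
    conv_lhs => rw [← h.sum_smul p v]
    simp only [map_sum, map_smul, smul_sub, Finset.sum_sub_distrib]
  have hea : ∀ a, cov V p (cov (e a) p (e a p)) - cov (fun q ↦ cov V q (e a q)) p (e a p) =
      ∑ j, ∑ i, (θ j p (e a p) * θ i p (e a p)) •
        (cov V p (cov (X j) p (X i p)) - cov (fun q ↦ cov V q (X j q)) p (X i p)) := by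
    intro a
    rw [h.tensorialAt_eq_sum (hQ (e a p)) (hed a)]
    refine Finset.sum_congr rfl fun j _ ↦ ?_
    rw [hlin, Finset.smul_sum]
    exact Finset.sum_congr rfl fun i _ ↦ smul_smul _ _ _
  have hsum := sum_coframe_mul_coframe hn (he.orthonormal p hpN') hm
  rw [roughLaplacian, Finset.sum_congr rfl fun a _ ↦ hea a, Finset.sum_comm]
  refine Finset.sum_congr rfl fun j _ ↦ ?_
  rw [Finset.sum_comm]
  simp only [← Finset.sum_smul, hsum]
  simp

end Frame

/-! ### Lie brackets on the product of the line with a manifold. -/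

section ProductBracket

open VectorField Filter Topology

theorem ContinuousLinearMap.IsInvertible.inverse_fst_prod_comp_snd
    {E F F' : Type*} [NormedAddCommGroup E] [NormedSpace ℝ E] [NormedAddCommGroup F]
    [NormedSpace ℝ F] [NormedAddCommGroup F'] [NormedSpace ℝ F'] {A : F →L[ℝ] F'}
    (hA : A.IsInvertible) (w : E × F') :
    ((ContinuousLinearMap.fst ℝ E F).prod (A ∘L ContinuousLinearMap.snd ℝ E F)).inverse w =
      (w.1, A.inverse w.2) := by
  rw [ContinuousLinearMap.inverse_eq (g := (ContinuousLinearMap.fst ℝ E F').prod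
    (A.inverse ∘L ContinuousLinearMap.snd ℝ E F'))]
  · simp
  · ext v <;> simp [hA.self_apply_inverse]
  · ext v <;> simp [hA.inverse_apply_self]

variable {F : Type*} [NormedAddCommGroup F] [NormedSpace ℝ F] [CompleteSpace F]
  {H' : Type*} [TopologicalSpace H'] {J : ModelWithCorners ℝ F H'} [J.Boundaryless]
  {N : Type*} [TopologicalSpace N] [ChartedSpace H' N] [IsManifold J 2 N]

/-- The vector field `φ(t) ∂ₜ + V` on `ℝ × N`. -/
def prodField (φ : ℝ → ℝ) (V : ∀ x : N, TangentSpace J x) :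
    ∀ p : ℝ × N, TangentSpace (𝓘(ℝ, ℝ).prod J) p :=
  fun p ↦ ((φ p.1, V p.2) : ℝ × TangentSpace J p.2)

/-- The vector field `V` read in the extended chart at `x₀`. -/
def chartField (x₀ : N) (V : ∀ x : N, TangentSpace J x) : F → F :=
  mpullbackWithin 𝓘(ℝ, F) J (extChartAt J x₀).symm V (Set.range J)

/-- Without boundary the range of the model is everything, so brackets within a set become ordinary
brackets in the chart. -/
theorem mlieBracket_eq_lieBracket_chartField (x : N) (V W : ∀ x : N, TangentSpace J x) :
    mlieBracket J V W x = (mfderiv J 𝓘(ℝ, F) (extChartAt J x) x).inverse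
      (lieBracket ℝ (chartField x V) (chartField x W) (extChartAt J x x) : F) := by
  rw [← lieBracketWithin_univ, ← mlieBracketWithin_univ, mlieBracketWithin_apply,
    Set.preimage_univ, Set.univ_inter]
  conv_rhs => rw [← J.range_eq_univ]
  rfl

theorem differentiableAt_chartField {x : N} {V : ∀ x : N, TangentSpace J x}
    (hV : MDiffAt (T% V) x) : DifferentiableAt ℝ (chartField x V) (extChartAt J x x) := by
  have : DifferentiableWithinAt ℝ (chartField x V) _ _ :=
    MDifferentiableWithinAt.differentiableWithinAt_mpullbackWithin_vectorField
      (mdifferentiableWithinAt_univ.2 hV)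
  rwa [J.range_eq_univ, Set.preimage_univ, Set.univ_inter, differentiableWithinAt_univ] at this

/-- The product chart is the identity times a chart of `N`; its derivative is block diagonal, so the
pullback acts on each factor separately. -/
theorem chartField_prodField (p : ℝ × N) (r : ℝ)
    (V : ∀ x : N, TangentSpace J x) {z : ℝ × F} (hz : z.2 ∈ (extChartAt J p.2).target) :
    chartField p (prodField (fun _ ↦ r) V) z = (r, chartField p.2 V z.2) := by
  unfold chartField
  have : IsManifold J 1 N := .of_le (n := 2) (by norm_num)
  have hinv := isInvertible_mfderivWithin_extChartAt_symm hz
  have hd := (mdifferentiableWithinAt_extChartAt_symm hz).hasMFDerivWithinAt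
  rw [J.range_eq_univ] at hd hinv ⊢
  rw [(𝓘(ℝ, ℝ).prod J).range_eq_univ]
  simp only [hasMFDerivWithinAt_univ] at hd
  have h1 : HasMFDerivAt 𝓘(ℝ, ℝ × F) 𝓘(ℝ, ℝ) (Prod.fst : ℝ × F → ℝ) z
    (ContinuousLinearMap.fst ℝ ℝ F) := (ContinuousLinearMap.fst ℝ ℝ F).hasMFDerivAt
  have h2 : HasMFDerivAt 𝓘(ℝ, ℝ × F) 𝓘(ℝ, F) (Prod.snd : ℝ × F → F) z
    (ContinuousLinearMap.snd ℝ ℝ F) := (ContinuousLinearMap.snd ℝ ℝ F).hasMFDerivAt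
  have h3 := h1.prodMk (HasMFDerivAt.comp z hd h2)
  have h4 : ((extChartAt (𝓘(ℝ, ℝ).prod J) p).symm : ℝ × F → ℝ × N) =
      fun y ↦ (y.1, ((extChartAt J p.2).symm ∘ Prod.snd) y) := by
    rw [extChartAt_prod]
    rfl
  have h5 := h3.mfderiv
  rw [← h4, ← mfderivWithin_univ] at h5
  have h6 : prodField (fun _ ↦ r) V ((extChartAt (𝓘(ℝ, ℝ).prod J) p).symm z) =
      ((r, V ((extChartAt J p.2).symm z.2)) : ℝ × F) := by
    rw [extChartAt_prod]
    rfl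
  refine (congrArg₂ (fun (A : ℝ × F →L[ℝ] ℝ × F) w ↦ A.inverse w) h5 h6).trans ?_
  exact ContinuousLinearMap.IsInvertible.inverse_fst_prod_comp_snd (E := ℝ) (F := F) (F' := F)
    hinv (r, V ((extChartAt J p.2).symm z.2))

theorem mfderiv_extChartAt_prod_inverse (p : ℝ × N) (w : ℝ × F) :
    (mfderiv (𝓘(ℝ, ℝ).prod J) 𝓘(ℝ, ℝ × F) (extChartAt (𝓘(ℝ, ℝ).prod J) p) p).inverse w =
    ((w.1, (mfderiv J 𝓘(ℝ, F) (extChartAt J p.2) p.2).inverse w.2) :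
      ℝ × TangentSpace J p.2) := by
  have : IsManifold J 1 N := .of_le (n := 2) (by norm_num)
  have hinv := isInvertible_mfderiv_extChartAt (I := J) (mem_extChartAt_source (I := J) p.2)
  have hd := (mdifferentiableAt_extChartAt (I := J) (mem_chart_source H' p.2)).hasMFDerivAt
  have h1 := hasMFDerivAt_fst (I := 𝓘(ℝ, ℝ)) (I' := J) p
  have h2 := hasMFDerivAt_snd (I := 𝓘(ℝ, ℝ)) (I' := J) p
  have h3 := HasMFDerivAt.comp p hd h2
  have h4 : (extChartAt (𝓘(ℝ, ℝ).prod J) p : ℝ × N → ℝ × F) =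
      fun y ↦ (y.1, ((extChartAt J p.2) ∘ Prod.snd) y) := by
    rw [extChartAt_prod]
    rfl
  have h5 : HasMFDerivAt (𝓘(ℝ, ℝ).prod J) 𝓘(ℝ, ℝ × F)
      (fun y : ℝ × N ↦ (y.1, ((extChartAt J p.2) ∘ Prod.snd) y)) p
      ((ContinuousLinearMap.fst ℝ ℝ F).prod
        ((mfderiv J 𝓘(ℝ, F) (extChartAt J p.2) p.2 : F →L[ℝ] F) ∘L
          ContinuousLinearMap.snd ℝ ℝ F)) :=
    ⟨h1.1.prodMk h3.1, HasFDerivWithinAt.prodMk (F := ℝ) (G := F) h1.2 h3.2⟩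
  have h6 := h5.mfderiv
  rw [← h4] at h6
  refine (congrArg (fun A : ℝ × F →L[ℝ] ℝ × F ↦ A.inverse w) h6).trans ?_
  exact ContinuousLinearMap.IsInvertible.inverse_fst_prod_comp_snd (E := ℝ) (F := F) (F' := F)
    hinv w

/-- In the product chart the first components are constant and the second ones depend on the second
variable only, so just the bracket on `N` survives. -/
theorem mlieBracket_prodField (r s : ℝ) {V W : ∀ x : N, TangentSpace J x} (p : ℝ × N)
    (hV : MDiffAt (T% V) p.2) (hW : MDiffAt (T% W) p.2) :
    mlieBracket (𝓘(ℝ, ℝ).prod J) (prodField (fun _ ↦ r) V) (prodField (fun _ ↦ s) W) p =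
    prodField (fun _ ↦ 0) (mlieBracket J V W) p := by
  have hp2 : (extChartAt (𝓘(ℝ, ℝ).prod J) p p : ℝ × F).2 = extChartAt J p.2 p.2 := by
    rw [extChartAt_prod]
    rfl
  have hev : ∀ (r : ℝ) (V : ∀ x : N, TangentSpace J x),
      chartField p (prodField (fun _ ↦ r) V) =ᶠ[𝓝 (extChartAt (𝓘(ℝ, ℝ).prod J) p p)]
      fun z ↦ (r, chartField p.2 V z.2) := by
    intro r V
    have h2 : Prod.snd ⁻¹' (extChartAt J p.2).target ∈
        𝓝 (extChartAt (𝓘(ℝ, ℝ).prod J) p p : ℝ × F) := by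
      refine continuous_snd.continuousAt.preimage_mem_nhds ?_
      rw [hp2]
      exact extChartAt_target_mem_nhds _
    filter_upwards [h2] with z hz
    exact chartField_prodField p r V hz
  have hfd : ∀ (r : ℝ) {V : ∀ x : N, TangentSpace J x}, MDiffAt (T% V) p.2 → HasFDerivAt (𝕜 := ℝ)
      (fun z : ℝ × F ↦ (r, chartField p.2 V z.2)) ((0 : ℝ × F →L[ℝ] ℝ).prod
          (fderiv ℝ (chartField p.2 V) (extChartAt J p.2 p.2) ∘L ContinuousLinearMap.snd ℝ ℝ F))
        (extChartAt (𝓘(ℝ, ℝ).prod J) p p : ℝ × F) := by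
    intro r V hV
    have h := (differentiableAt_chartField hV).hasFDerivAt
    rw [← hp2] at h ⊢
    exact (hasFDerivAt_const r _).prodMk (h.comp _ hasFDerivAt_snd)
  have hbr : lieBracket ℝ (chartField p (prodField (fun _ ↦ r) V))
      (chartField p (prodField (fun _ ↦ s) W)) (extChartAt (𝓘(ℝ, ℝ).prod J) p p) =
      ((0, lieBracket ℝ (chartField p.2 V) (chartField p.2 W) (extChartAt J p.2 p.2)) :
          ℝ × F) := by
    rw [(hev r V).lieBracket_vectorField_eq (hev s W)]
    simp only [lieBracket, (hfd r hV).fderiv, (hfd s hW).fderiv, hp2]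
    simp
  rw [mlieBracket_eq_lieBracket_chartField, hbr, mfderiv_extChartAt_prod_inverse, prodField,
    mlieBracket_eq_lieBracket_chartField]

end ProductBracket

/-! ### Smooth fields on the product, left-invariant fields and orthonormal bases. -/

section LieGroupProduct

open VectorField Bundle

variable {F : Type*} [NormedAddCommGroup F] [NormedSpace ℝ F]
  {H' : Type*} [TopologicalSpace H'] {J : ModelWithCorners ℝ F H'}
  {N : Type*} [TopologicalSpace N] [ChartedSpace H' N] [IsManifold J 1 N]

theorem contMDiffOn_prodField {n : ℕ∞ω} {S : Set ℝ} {φ : ℝ → ℝ} (hφ : ContDiffOn ℝ n φ S)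
    {V : ∀ x : N, TangentSpace J x} (hV : CMDiff n (T% V)) :
    CMDiff[S ×ˢ (Set.univ : Set N)] n (T% (prodField φ V)) := by
  have h1 : ContMDiffOn (𝓘(ℝ, ℝ).prod J) (𝓘(ℝ, ℝ).tangent) n
      (fun p : ℝ × N ↦ (⟨p.1, φ p.1⟩ : TangentBundle 𝓘(ℝ, ℝ) ℝ)) (S ×ˢ Set.univ) :=
    ContMDiffOn.comp (t := S) (contMDiffOn_vectorSpace_iff_contDiffOn.2 hφ) contMDiffOn_fst
      fun p hp ↦ hp.1
  have h2 : ContMDiffOn (𝓘(ℝ, ℝ).prod J) J.tangent n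
      (fun p : ℝ × N ↦ (⟨p.2, V p.2⟩ : TangentBundle J N)) (S ×ˢ Set.univ) :=
    hV.comp_contMDiffOn contMDiffOn_snd
  exact (contMDiff_equivTangentBundleProd_symm (I := 𝓘(ℝ, ℝ)) (I' := J)).comp_contMDiffOn
    (h1.prodMk h2)

theorem mdifferentiableAt_snd_section {Y : ∀ p : ℝ × N, TangentSpace (𝓘(ℝ, ℝ).prod J) p}
    {p : ℝ × N} (hY : MDiffAt (T% Y) p) :
    MDifferentiableAt (𝓘(ℝ, ℝ).prod J) J.tangent
      (fun q : ℝ × N ↦ (⟨q.2, (Y q : ℝ × TangentSpace J q.2).2⟩ : TangentBundle J N)) p := by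
  have h1 := (contMDiff_equivTangentBundleProd (I := 𝓘(ℝ, ℝ)) (M := ℝ) (I' := J) (M' := N) (n := 1)
    ).mdifferentiable one_ne_zero
  exact mdifferentiableAt_snd.comp p ((h1 _).comp p hY)

theorem mdifferentiableAt_fst_section {Y : ∀ p : ℝ × N, TangentSpace (𝓘(ℝ, ℝ).prod J) p}
    {p : ℝ × N} (hY : MDiffAt (T% Y) p) :
    MDiffAt (fun q : ℝ × N ↦ (Y q : ℝ × TangentSpace J q.2).1) p := by
  have h1 := (contMDiff_equivTangentBundleProd (I := 𝓘(ℝ, ℝ)) (M := ℝ) (I' := J) (M' := N) (n := 1)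
    ).mdifferentiable one_ne_zero
  have h2 : MDifferentiableAt (𝓘(ℝ, ℝ).prod J) 𝓘(ℝ, ℝ).tangent
      (fun q : ℝ × N ↦ (⟨q.1, (Y q : ℝ × TangentSpace J q.2).1⟩ : TangentBundle 𝓘(ℝ, ℝ) ℝ)) p :=
    mdifferentiableAt_fst.comp p ((h1 _).comp p hY)
  exact ((contMDiff_snd_tangentBundle_modelSpace ℝ 𝓘(ℝ, ℝ) (n := 1)).mdifferentiable
    one_ne_zero _).comp p h2

section Smooth

variable {G : Type*} [TopologicalSpace G] [ChartedSpace H' G] [Group G] [LieGroup J ∞ G]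

/-- The value at g is the tangent map of the multiplication at (g, 1) applied to (0, v): a composite
of the zero section, a constant and the tangent map of a smooth map. -/
theorem contMDiff_infty_mulInvariantVectorField (v : GroupLieAlgebra J G) :
    CMDiff ∞ (T% (mulInvariantVectorField v : ∀ g : G, TangentSpace J g)) := by
  have : IsManifold J 1 G := .of_le (n := ∞) (by simp)
  let fg : G → TangentBundle J G := fun g ↦ TotalSpace.mk' F g 0
  have sfg : CMDiff ∞ fg := contMDiff_zeroSection _ _
  let fv : G → TangentBundle J G := fun _ ↦ TotalSpace.mk' F 1 v
  have sfv : CMDiff ∞ fv := contMDiff_const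
  let F₁ : G → (TangentBundle J G × TangentBundle J G) := fun g ↦ (fg g, fv g)
  have S₁ : CMDiff ∞ F₁ := sfg.prodMk sfv
  let F₂ : (TangentBundle J G × TangentBundle J G) → TangentBundle (J.prod J) (G × G) :=
    (equivTangentBundleProd J G J G).symm
  have S₂ : CMDiff ∞ F₂ := contMDiff_equivTangentBundleProd_symm
  let F₃ : TangentBundle (J.prod J) (G × G) → TangentBundle J G :=
    tangentMap% (fun (p : G × G) ↦ p.1 * p.2)
  have S₃ : CMDiff ∞ F₃ :=
    ContMDiff.contMDiff_tangentMap (contMDiff_mul J ∞) (m := ∞) (by simp)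
  have S := (S₃.comp S₂).comp S₁
  refine S.congr fun g ↦ ?_
  simp only [Function.comp_apply, F₁, F₂, F₃, tangentMap, fg, fv]
  rw [mfderiv_prod_eq_add_apply ((contMDiff_mul J ∞).mdifferentiable (by simp) _)]
  have hz : ∀ (A : F →L[ℝ] F) (w : F), w = A 0 + w := by
    intro A w
    rw [map_zero, zero_add]
  -- The tangent map lands over `g * 1`, which equals `g` only propositionally; the vectors are
  -- compared in the model space.
  have hpt : g = g * 1 := (mul_one g).symm
  have : ∀ (x : G) (w w' : F), g = x → w = w' →
    (TotalSpace.mk' F g w : TangentBundle J G) = TotalSpace.mk' F x w' := by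
    rintro x w w' rfl rfl
    rfl
  exact this _ _ _ hpt (hz _ _)

end Smooth

variable {G : Type*} [TopologicalSpace G] [ChartedSpace (EuclideanSpace ℝ (Fin 3)) G] [Group G]
  [LieGroup (𝓡 3) ∞ G]

theorem LieGroup.of_infty_minSmoothness : LieGroup (𝓡 3) (minSmoothness ℝ 3) G := by
  rw [minSmoothness_of_isRCLikeNormedField]
  infer_instance

theorem SmoothMetric.IsLeftInvariant.inner_mulInvariantVectorField {gG : SmoothMetric G}
    (h : gG.IsLeftInvariant) (v w : GroupLieAlgebra (𝓡 3) G) (x : G) :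
    gG.inner x (mulInvariantVectorField v x) (mulInvariantVectorField w x) = gG.inner 1 v w := by
  -- Invariance gives the identity at `x * 1`; a free base point `y` permits the substitution.
  have key : ∀ y, x * 1 = y → (gG.inner y (mulInvariantVectorField v x : EuclideanSpace ℝ (Fin 3))
      (mulInvariantVectorField w x : EuclideanSpace ℝ (Fin 3)) = gG.inner 1 v w) := by
    rintro y rfl
    exact h x 1 v w
  exact key x (mul_one x)

theorem mlieBracket_mulInvariantVectorField (v w : GroupLieAlgebra (𝓡 3) G) :
    mlieBracket (𝓡 3) (mulInvariantVectorField v : ∀ g : G, TangentSpace (𝓡 3) g)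
      (mulInvariantVectorField w) = mulInvariantVectorField ⁅v, w⁆ := by
  have : LieGroup (𝓡 3) (minSmoothness ℝ 3) G := LieGroup.of_infty_minSmoothness
  rw [GroupLieAlgebra.bracket_def, mulInvariantVector_mlieBracket]

section Orthonormal

variable {E : Type*} [NormedAddCommGroup E] [NormedSpace ℝ E] [FiniteDimensional ℝ E] {n : ℕ}
  {B : E →L[ℝ] E →L[ℝ] ℝ} {e : Fin n → E}

/-- Orthonormality gives linear independence, and the dimension count makes the family a basis. -/
theorem sum_orthonormal_smul_eq (hn : Module.finrank ℝ E = n)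
    (he : ∀ i j, B (e i) (e j) = if i = j then 1 else 0) (v : E) : ∑ i, B (e i) v • e i = v := by
  have hli : LinearIndependent ℝ e := by
    rw [Fintype.linearIndependent_iff]
    intro c hc i
    have := congrArg (B (e i)) hc
    simpa [he] using this
  have hv : v ∈ Submodule.span ℝ (Set.range e) := by
    rw [hli.span_eq_top_of_card_eq_finrank' (by simp [hn])]
    trivial
  obtain ⟨c, rfl⟩ := (Submodule.mem_span_range_iff_exists_fun ℝ).1 hv
  simp [he]

theorem eq_sum_orthonormal_mul (hn : Module.finrank ℝ E = n)
    (he : ∀ i j, B (e i) (e j) = if i = j then 1 else 0) (v w : E) :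
    B v w = ∑ i, B (e i) v * B (e i) w := by
  conv_lhs => rw [← sum_orthonormal_smul_eq hn he v]
  simp

theorem smul_one_zero_add_sum_smul_zero_left (a : ℝ) (c : Fin n → ℝ) (u : Fin n → E) :
    a • ((1, 0) : ℝ × E) + ∑ i, c i • ((0, u i) : ℝ × E) = (a, ∑ i, c i • u i) := by
  ext
  · simp [Prod.fst_sum]
  · simp [Prod.snd_sum]

end Orthonormal

end LieGroupProduct

/-! ### The frame of ∂ₜ and the left-invariant fields; the warped metric is diagonal in it. -/

section WarpedFrame

open VectorField Bundle

variable {G : Type*} [TopologicalSpace G] [ChartedSpace (EuclideanSpace ℝ (Fin 3)) G] [Group G]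
  [LieGroup (𝓡 3) ∞ G]

/-- The frame of `ℝ × G` consisting of `∂ₜ` and of three left-invariant vector fields of `G`. -/
def warpedFrame (e : Fin 3 → GroupLieAlgebra (𝓡 3) G) (i : Fin 4) :
    ∀ p : ℝ × G, TangentSpace (𝓘(ℝ, ℝ).prod (𝓡 3)) p :=
  prodField (fun _ ↦ (Fin.cons 1 0 : Fin 4 → ℝ) i)
    (mulInvariantVectorField ((Fin.cons 0 e : Fin 4 → GroupLieAlgebra (𝓡 3) G) i))

/-- The coframe dual to `warpedFrame e` if `e` is orthonormal for `gG`. -/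
def warpedCoframe (gG : SmoothMetric G) (e : Fin 3 → GroupLieAlgebra (𝓡 3) G) (i : Fin 4)
    (p : ℝ × G) : TangentSpace (𝓘(ℝ, ℝ).prod (𝓡 3)) p →L[ℝ] ℝ :=
  ((Fin.cons 1 0 : Fin 4 → ℝ) i • ContinuousLinearMap.fst ℝ ℝ (TangentSpace (𝓡 3) p.2) +
    gG.inner p.2 (mulInvariantVectorField ((Fin.cons 0 e : Fin 4 → GroupLieAlgebra (𝓡 3) G) i) p.2)
      ∘L ContinuousLinearMap.snd ℝ ℝ (TangentSpace (𝓡 3) p.2) :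
    ℝ × TangentSpace (𝓡 3) p.2 →L[ℝ] ℝ)

theorem mulInvariantVectorField_zero (x : G) :
    mulInvariantVectorField (0 : GroupLieAlgebra (𝓡 3) G) x = 0 :=
  map_zero (mfderiv (𝓡 3) (𝓡 3) (fun y ↦ x * y) 1)

variable {gG : SmoothMetric G} {e : Fin 3 → GroupLieAlgebra (𝓡 3) G}

theorem warpedCoframe_zero (p : ℝ × G) (v : TangentSpace (𝓘(ℝ, ℝ).prod (𝓡 3)) p) :
    warpedCoframe gG e 0 p v = (v : ℝ × TangentSpace (𝓡 3) p.2).1 := by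
  have h : warpedCoframe gG e 0 p v = (1 : ℝ) * (v : ℝ × TangentSpace (𝓡 3) p.2).1 +
    gG.inner p.2 (mulInvariantVectorField (0 : GroupLieAlgebra (𝓡 3) G) p.2)
      (v : ℝ × TangentSpace (𝓡 3) p.2).2 := rfl
  rw [h, mulInvariantVectorField_zero, map_zero, one_mul]
  exact add_zero _

theorem warpedCoframe_succ (i : Fin 3) (p : ℝ × G)
    (v : TangentSpace (𝓘(ℝ, ℝ).prod (𝓡 3)) p) :
    warpedCoframe gG e i.succ p v = gG.inner p.2 (mulInvariantVectorField (e i) p.2)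
      (v : ℝ × TangentSpace (𝓡 3) p.2).2 := by
  have h : warpedCoframe gG e i.succ p v = (0 : ℝ) * (v : ℝ × TangentSpace (𝓡 3) p.2).1 +
    gG.inner p.2 (mulInvariantVectorField (e i) p.2) (v : ℝ × TangentSpace (𝓡 3) p.2).2 := rfl
  rw [h, zero_mul, zero_add]

theorem warpedFrame_zero (p : ℝ × G) :
    warpedFrame e 0 p = ((1, 0) : ℝ × TangentSpace (𝓡 3) p.2) :=
  congrArg (fun w ↦ ((1, w) : ℝ × TangentSpace (𝓡 3) p.2)) (mulInvariantVectorField_zero p.2)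

theorem warpedFrame_succ (i : Fin 3) (p : ℝ × G) :
    warpedFrame e i.succ p = ((0, mulInvariantVectorField (e i) p.2) :
      ℝ × TangentSpace (𝓡 3) p.2) := rfl

theorem contMDiff_warpedFrame (i : Fin 4) :
    ContMDiff (𝓘(ℝ, ℝ).prod (𝓡 3)) (𝓘(ℝ, ℝ).prod (𝓡 3)).tangent ∞
      (fun p ↦ (⟨p, warpedFrame e i p⟩ : TangentBundle (𝓘(ℝ, ℝ).prod (𝓡 3)) (ℝ × G))) := by
  rw [← contMDiffOn_univ, ← Set.univ_prod_univ]
  exact contMDiffOn_prodField contDiffOn_const (contMDiff_infty_mulInvariantVectorField _)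

theorem mdifferentiableAt_warpedCoframe (i : Fin 4) {p : ℝ × G}
    {Y : ∀ q : ℝ × G, TangentSpace (𝓘(ℝ, ℝ).prod (𝓡 3)) q}
    (hY : MDifferentiableAt (𝓘(ℝ, ℝ).prod (𝓡 3)) (𝓘(ℝ, ℝ).prod (𝓡 3)).tangent
      (fun q ↦ (⟨q, Y q⟩ : TangentBundle (𝓘(ℝ, ℝ).prod (𝓡 3)) (ℝ × G))) p) :
    MDifferentiableAt (𝓘(ℝ, ℝ).prod (𝓡 3)) 𝓘(ℝ, ℝ) (fun q ↦ warpedCoframe gG e i q (Y q)) p := by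
  cases i using Fin.cases with
  | zero =>
    simp only [warpedCoframe_zero]
    exact mdifferentiableAt_fst_section hY
  | succ i =>
    simp only [warpedCoframe_succ]
    have h1 : MDifferentiableAt (𝓘(ℝ, ℝ).prod (𝓡 3)) (𝓡 3).tangent (fun q : ℝ × G ↦
        (⟨q.2, mulInvariantVectorField (e i) q.2⟩ : TangentBundle (𝓡 3) G)) p :=
      ((contMDiff_infty_mulInvariantVectorField (e i)).mdifferentiable (by simp) _).comp p
        mdifferentiableAt_snd
    have h2 := mdifferentiableAt_snd_section hY
    have h3 := ((gG.contMDiff.mdifferentiable (by simp)) p.2).comp p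
      (mdifferentiableAt_snd (I := 𝓘(ℝ, ℝ)) (I' := 𝓡 3) (x := p))
    have h4 := MDifferentiableAt.clm_bundle_apply₂ (F₁ := EuclideanSpace ℝ (Fin 3))
      (F₂ := EuclideanSpace ℝ (Fin 3)) (F₃ := ℝ) (E₃ := fun _ : G ↦ ℝ) h3 h1 h2
    exact (mdifferentiableAt_totalSpace _ _).1 h4 |>.2

theorem sum_inner_smul_mulInvariantVectorField (hgG : gG.IsLeftInvariant)
    (he : ∀ i j, gG.inner 1 (e i) (e j) = if i = j then 1 else 0) (x : G) (v : TangentSpace (𝓡 3) x) :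
    ∑ i, gG.inner x (mulInvariantVectorField (e i) x) v • mulInvariantVectorField (e i) x = v :=
  sum_orthonormal_smul_eq (E := EuclideanSpace ℝ (Fin 3)) (B := gG.inner x) (by simp)
    (fun i j ↦ (hgG.inner_mulInvariantVectorField (e i) (e j) x).trans (he i j)) v

theorem isDualFrame_warpedFrame (hgG : gG.IsLeftInvariant)
    (he : ∀ i j, gG.inner 1 (e i) (e j) = if i = j then 1 else 0) :
    IsDualFrame (warpedFrame e) (warpedCoframe gG e) where
  mdifferentiableAt i p := (contMDiff_warpedFrame i).mdifferentiable (by simp) p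
  mdifferentiableAt_coframe i p Y hY := mdifferentiableAt_warpedCoframe i hY
  coframe_apply p i j := by
    cases i using Fin.cases with
    | zero =>
      rw [warpedCoframe_zero]
      cases j using Fin.cases with
      | zero => rfl
      | succ j => exact (if_neg (Fin.succ_ne_zero j).symm).symm
    | succ i =>
      rw [warpedCoframe_succ]
      cases j using Fin.cases with
      | zero =>
        rw [warpedFrame_zero, if_neg (Fin.succ_ne_zero i)]
        exact map_zero _
      | succ j =>
        rw [warpedFrame_succ]
        simp only [hgG.inner_mulInvariantVectorField, he, Fin.succ_inj]
  sum_smul p v := by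
    rw [Fin.sum_univ_succ]
    simp only [warpedCoframe_zero, warpedCoframe_succ, warpedFrame_zero, warpedFrame_succ]
    exact (smul_one_zero_add_sum_smul_zero_left (E := EuclideanSpace ℝ (Fin 3)) _ _ _).trans
      (congrArg (Prod.mk (v : ℝ × EuclideanSpace ℝ (Fin 3)).1)
        (sum_inner_smul_mulInvariantVectorField hgG he p.2 (v : ℝ × TangentSpace (𝓡 3) p.2).2))

theorem warpedMetric_eq_diagonalMetric (hgG : gG.IsLeftInvariant)
    (he : ∀ i j, gG.inner 1 (e i) (e j) = if i = j then 1 else 0) (f : ℝ → ℝ) :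
    warpedMetric f gG = diagonalMetric (warpedCoframe gG e)
      (fun i p ↦ (Fin.cons 1 (fun _ ↦ f p.1 ^ 2) : Fin 4 → ℝ) i) := by
  ext p v w
  have h1 : ∀ v, mvfderiv (𝓘(ℝ, ℝ).prod (𝓡 3)) (Prod.fst : ℝ × G → ℝ) p v =
      (v : ℝ × TangentSpace (𝓡 3) p.2).1 := fun v ↦
    congrArg (fun A : ℝ × EuclideanSpace ℝ (Fin 3) →L[ℝ] ℝ ↦ A v)
      (hasMFDerivAt_fst (I := 𝓘(ℝ, ℝ)) (I' := 𝓡 3) p).mfderiv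
  have h2 : ∀ v, mfderiv (𝓘(ℝ, ℝ).prod (𝓡 3)) (𝓡 3) (Prod.snd : ℝ × G → G) p v =
      (v : ℝ × TangentSpace (𝓡 3) p.2).2 := fun v ↦
    congrArg (fun A : ℝ × EuclideanSpace ℝ (Fin 3) →L[ℝ] EuclideanSpace ℝ (Fin 3) ↦ A v)
      (hasMFDerivAt_snd (I := 𝓘(ℝ, ℝ)) (I' := 𝓡 3) p).mfderiv
  have h3 := eq_sum_orthonormal_mul (E := EuclideanSpace ℝ (Fin 3)) (B := gG.inner p.2) (by simp)
    (fun i j ↦ (hgG.inner_mulInvariantVectorField (e i) (e j) p.2).trans (he i j))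
    (v : ℝ × EuclideanSpace ℝ (Fin 3)).2 (w : ℝ × EuclideanSpace ℝ (Fin 3)).2
  rw [diagonalMetric, Fin.sum_univ_succ]
  simp only [warpedCoframe_zero, warpedCoframe_succ, Fin.cons_zero, Fin.cons_succ, warpedMetric,
    h1, one_mul, ← Finset.mul_sum]
  congr 2
  exact (congrArg₂ (fun a b : EuclideanSpace ℝ (Fin 3) ↦ gG.inner p.2 a b) (h2 v) (h2 w)).trans h3

end WarpedFrame

/-! ### The rough Laplacian when all coefficients depend on a single function τ. -/

section ChristoffelSymbols

open VectorField

variable {E : Type*} [NormedAddCommGroup E] [NormedSpace ℝ E]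
  {H : Type*} [TopologicalSpace H] {I : ModelWithCorners ℝ E H}
  {M : Type*} [TopologicalSpace M] [ChartedSpace H M]
  {ι : Type} [Fintype ι]

/-- The covariant differentials of the frame fields `X j` with `∇_{X i} (X j) = ∑ k, Γ i j k X k`,
where the Christoffel symbols `Γ` are functions of `τ`. -/
def christoffelForm (X : ι → ∀ p : M, TangentSpace I p)
    (θ : ι → ∀ p : M, TangentSpace I p →L[ℝ] ℝ) (Γ : ℝ → ι → ι → ι → ℝ) (τ : M → ℝ)
    (j : ι) (p : M) : TangentSpace I p →L[ℝ] TangentSpace I p :=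
  ∑ i, ∑ k, Γ (τ p) i j k • (θ i p).smulRight (X k p)

variable [DecidableEq ι] [IsManifold I 1 M]
  {X : ι → ∀ p : M, TangentSpace I p} {θ : ι → ∀ p : M, TangentSpace I p →L[ℝ] ℝ}
  {Γ : ℝ → ι → ι → ι → ℝ} {τ : M → ℝ} {r : ι → ℝ} {m : ι → M → ℝ}

namespace IsDualFrame

theorem christoffelForm_apply (h : IsDualFrame X θ) (i j : ι) (p : M) :
    christoffelForm X θ Γ τ j p (X i p) = ∑ k, Γ (τ p) i j k • X k p := by
  simp [christoffelForm, sum_apply, smul_apply, ContinuousLinearMap.smulRight_apply,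
    h.coframe_apply]

theorem coframe_christoffelForm_apply (h : IsDualFrame X θ) (i j k : ι) (p : M) :
    θ k p (christoffelForm X θ Γ τ j p (X i p)) = Γ (τ p) i j k := by
  simp [h.christoffelForm_apply, h.coframe_apply]

theorem coframe_sum_smul (h : IsDualFrame X θ) (c : ι → ℝ) (k : ι) (p : M) :
    θ k p (∑ j, c j • X j p) = c k := by
  simp [h.coframe_apply]

theorem mdifferentiableAt_sum_smul (h : IsDualFrame X θ) {c : ι → ℝ → ℝ} {p : M}
    (hτ : MDiffAt τ p) (hc : ∀ j, DifferentiableAt ℝ (c j) (τ p)) :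
    MDiffAt (T% (fun q ↦ ∑ j, c j (τ q) • X j q)) p :=
  MDifferentiableAt.sum_section (t := fun j q ↦ c j (τ q) • X j q) fun j _ ↦
    ((hc j).mdifferentiableAt.comp p hτ).smul_section (h.mdifferentiableAt j p)

theorem _root_.mvfderiv_comp_real {g : ℝ → ℝ} {p : M} (hg : DifferentiableAt ℝ g (τ p))
    (hτ : MDiffAt τ p) (v : TangentSpace I p) :
    mvfderiv I (fun q ↦ g (τ q)) p v = mvfderiv I τ p v * deriv g (τ p) := by
  have h : mvfderiv I (fun q ↦ g (τ q)) p v = fderiv ℝ g (τ p) (mvfderiv I τ p v) := by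
    rw [← mfderiv_eq_fderiv]
    exact mvfderiv_comp_apply p hg.mdifferentiableAt hτ v
  rw [h, fderiv_eq_smul_deriv, smul_eq_mul]

theorem frameConnection_sum_smul (h : IsDualFrame X θ) {c : ι → ℝ → ℝ} {p : M}
    (hτ : MDiffAt τ p) (hr : ∀ i, mvfderiv I τ p (X i p) = r i)
    (hc : ∀ j, DifferentiableAt ℝ (c j) (τ p)) (i : ι) :
    frameConnection X θ (christoffelForm X θ Γ τ) (fun q ↦ ∑ j, c j (τ q) • X j q) p (X i p) =
      ∑ k, (r i * deriv (c k) (τ p) + ∑ j, c j (τ p) * Γ (τ p) i j k) • X k p := by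
  have h1 : ∀ k, mvfderiv I (fun q ↦ c k (τ q)) p (X i p) = r i * deriv (c k) (τ p) := by
    intro k
    rw [mvfderiv_comp_real (hc k) hτ, hr]
  simp only [frameConnection, h.coframe_sum_smul, sum_apply, add_apply, smul_apply,
    ContinuousLinearMap.smulRight_apply, h1, h.christoffelForm_apply, Finset.smul_sum,
    Finset.sum_add_distrib, add_smul, Finset.sum_smul, smul_smul]
  rw [Finset.sum_comm]

/-- With dτ constant on each frame field, every covariant derivative acts on coefficients by an
ordinary derivative and a Christoffel term. `A i k` is the k-th component of ∇_{Xᵢ} V, left to the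
caller so that a closed form can be supplied. -/
theorem roughLaplacian_sum_smul (h : IsDualFrame X θ)
    (hn : Fintype.card ι = Module.finrank ℝ E) {N Ω : Set M} (hΩ : IsOpen Ω)
    {cov : (∀ p : M, TangentSpace I p) → ∀ p : M, TangentSpace I p →L[ℝ] TangentSpace I p}
    (hcov : IsLeviCivitaOn I (diagonalMetric θ m) Ω cov)
    (hΓ : IsLeviCivitaOn I (diagonalMetric θ m) Ω (frameConnection X θ (christoffelForm X θ Γ τ)))
    {e : Fin (Module.finrank ℝ E) → ∀ p : M, TangentSpace I p}
    (he : IsOrthonormalFrameOn I (diagonalMetric θ m) N e) {p : M} (hpN : N ∈ nhds p)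
    (hp : p ∈ Ω) (hm : ∀ i, ∀ q ∈ Ω, m i q ≠ 0) (hτ : ∀ q, MDiffAt τ q)
    (hr : ∀ q i, mvfderiv I τ q (X i q) = r i) {V : ∀ p : M, TangentSpace I p}
    {c : ι → ℝ → ℝ} (hV : V = fun q ↦ ∑ j, c j (τ q) • X j q)
    (hc : ∀ j, ∀ q ∈ Ω, DifferentiableAt ℝ (c j) (τ q))
    {A : ι → ι → ℝ → ℝ}
    (hA : ∀ i k, ∀ q ∈ Ω,
      r i * deriv (c k) (τ q) + ∑ j, c j (τ q) * Γ (τ q) i j k = A i k (τ q))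
    (hAd : ∀ i k, DifferentiableAt ℝ (A i k) (τ p)) :
    roughLaplacian I cov e V p = ∑ l, (∑ i, (m i p)⁻¹ * (∑ k, Γ (τ p) i i k * A k l (τ p) -
      (r i * deriv (A i l) (τ p) + ∑ j, A i j (τ p) * Γ (τ p) i j l))) • X l p := by
  have hVd : ∀ q ∈ Ω, MDiffAt (T% V) q := fun q hq ↦ by
    rw [hV]
    exact h.mdifferentiableAt_sum_smul (hτ q) fun j ↦ hc j q hq
  have hcovV : ∀ i, ∀ q ∈ Ω, cov V q (X i q) = ∑ k, A i k (τ q) • X k q := by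
    intro i q hq
    rw [hcov.eq h hΓ hq (fun i ↦ hm i q hq) (hVd q hq), hV,
      h.frameConnection_sum_smul (hτ q) (hr q) fun j ↦ hc j q hq]
    simp only [hA _ _ q hq]
  -- The formula for ∇_{Xᵢ} V holds on Ω only; a second differentiation needs just its germ at `p`.
  have hev : ∀ i, (fun q ↦ cov V q (X i q)) =ᶠ[nhds p] fun q ↦ ∑ k, A i k (τ q) • X k q :=
    fun i ↦ Filter.eventually_of_mem (hΩ.mem_nhds hp) (hcovV i)
  have hsec : ∀ i, MDiffAt (T% (fun q ↦ ∑ k, A i k (τ q) • X k q)) p := fun i ↦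
    h.mdifferentiableAt_sum_smul (hτ p) fun j ↦ hAd i j
  have hsec' : ∀ i, MDiffAt (T% (fun q ↦ cov V q (X i q))) p := fun i ↦
    (hsec i).congr_of_eventuallyEq ((hev i).mono fun q hq ↦ congrArg (Bundle.TotalSpace.mk q) hq)
  rw [h.roughLaplacian_eq hn hcov.isCovariantDerivativeOn he hpN hp (fun i ↦ hm i p hp) hsec']
  have h1 : ∀ i, cov (fun q ↦ cov V q (X i q)) p (X i p) =
      ∑ l, (r i * deriv (A i l) (τ p) + ∑ j, A i j (τ p) * Γ (τ p) i j l) • X l p := by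
    intro i
    rw [hcov.isCovariantDerivativeOn.congr_of_eventuallyEq (hsec' i) (hsec i)
      (hΩ.mem_nhds hp) (hev i),
      hcov.eq h hΓ hp (fun i ↦ hm i p hp) (hsec i),
      h.frameConnection_sum_smul (hτ p) (hr p) fun j ↦ hAd i j]
  have h2 : ∀ i, cov V p (cov (X i) p (X i p)) =
      ∑ l, (∑ k, Γ (τ p) i i k * A k l (τ p)) • X l p := by
    intro i
    rw [hcov.eq h hΓ hp (fun i ↦ hm i p hp) (h.mdifferentiableAt i p), h.frameConnection_self,
      h.christoffelForm_apply, map_sum]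
    simp only [map_smul, hcovV _ p hp, Finset.smul_sum, Finset.sum_smul, smul_smul]
    rw [Finset.sum_comm]
  simp only [h1, h2, ← Finset.sum_sub_distrib, ← sub_smul, Finset.smul_sum, smul_smul]
  rw [Finset.sum_comm]
  simp only [← Finset.sum_smul]

end IsDualFrame

end ChristoffelSymbols

/-! ### The Levi-Civita connection of the warped product. -/

section WarpedConnection

open VectorField

variable {G : Type*} [TopologicalSpace G] [ChartedSpace (EuclideanSpace ℝ (Fin 3)) G] [Group G]
  [LieGroup (𝓡 3) ∞ G]
  {gG : SmoothMetric G} {e : Fin 3 → GroupLieAlgebra (𝓡 3) G}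
  {e₁ e₂ e₃ : GroupLieAlgebra (𝓡 3) G} {α β δ : ℝ} {f φ : ℝ → ℝ} {J : Set ℝ}

/-- The Christoffel symbols of the warped product metric in the frame `warpedFrame ![e₁, e₂, e₃]`. -/
def warpedChristoffel (α β δ : ℝ) (f : ℝ → ℝ) (t : ℝ) : Fin 4 → Fin 4 → Fin 4 → ℝ :=
  ![![0, ![0, deriv f t / f t, 0, 0], ![0, 0, deriv f t / f t, 0], ![0, 0, 0, deriv f t / f t]],
    ![![0, deriv f t / f t, 0, 0], ![-(f t * deriv f t), 0, 0, 0], ![0, 0, 0, β], ![0, 0, -β, 0]],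
    ![![0, 0, deriv f t / f t, 0], ![0, 0, -α, 0], ![-(f t * deriv f t), α, 0, 0], 0],
    ![![0, 0, 0, deriv f t / f t], ![0, 0, 0, -δ], 0, ![-(f t * deriv f t), δ, 0, 0]]]

theorem GroupLieAlgebra.bracket_swap (v w : GroupLieAlgebra (𝓡 3) G) : ⁅v, w⁆ = -⁅w, v⁆ :=
  mlieBracket_swap_apply

theorem GroupLieAlgebra.bracket_self (v : GroupLieAlgebra (𝓡 3) G) : ⁅v, v⁆ = 0 := by
  rw [bracket_def, mlieBracket_self]
  rfl

theorem GroupLieAlgebra.zero_bracket (v : GroupLieAlgebra (𝓡 3) G) :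
    ⁅(0 : GroupLieAlgebra (𝓡 3) G), v⁆ = 0 := by
  have h : mulInvariantVectorField (0 : GroupLieAlgebra (𝓡 3) G) =
    (0 : ∀ x : G, TangentSpace (𝓡 3) x) := funext mulInvariantVectorField_zero
  rw [bracket_def, h, mlieBracket_zero_left]
  rfl

theorem GroupLieAlgebra.bracket_zero (v : GroupLieAlgebra (𝓡 3) G) :
    ⁅v, (0 : GroupLieAlgebra (𝓡 3) G)⁆ = 0 := by
  rw [bracket_swap, zero_bracket, neg_zero]

theorem sum_smul_warpedFrame (c : Fin 4 → ℝ) (p : ℝ × G) :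
    ∑ k, c k • warpedFrame e k p =
      prodField (fun _ ↦ c 0) (mulInvariantVectorField (∑ k : Fin 3, c k.succ • e k)) p := by
  rw [Fin.sum_univ_succ]
  simp only [warpedFrame_zero, warpedFrame_succ]
  have h : mulInvariantVectorField (∑ k : Fin 3, c k.succ • e k) p.2 =
      ∑ k : Fin 3, c k.succ • mulInvariantVectorField (e k) p.2 := by
    simp only [mulInvariantVectorField, map_sum, map_smul]
    rfl
  exact (smul_one_zero_add_sum_smul_zero_left (E := EuclideanSpace ℝ (Fin 3)) _ _ _).trans
    (congrArg (Prod.mk (c 0)) h.symm)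

theorem mlieBracket_warpedFrame (i j : Fin 4) (p : ℝ × G) :
    mlieBracket (𝓘(ℝ, ℝ).prod (𝓡 3)) (warpedFrame e i) (warpedFrame e j) p =
      prodField (fun _ ↦ 0) (mulInvariantVectorField
        ⁅(Fin.cons 0 e : Fin 4 → GroupLieAlgebra (𝓡 3) G) i,
          (Fin.cons 0 e : Fin 4 → GroupLieAlgebra (𝓡 3) G) j⁆) p := by
  have h : ∀ v : GroupLieAlgebra (𝓡 3) G, MDifferentiableAt (𝓡 3) (𝓡 3).tangent
      (T% (mulInvariantVectorField v : ∀ g : G, TangentSpace (𝓡 3) g)) p.2 := fun v ↦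
    (contMDiff_infty_mulInvariantVectorField v).mdifferentiable (by simp) p.2
  rw [warpedFrame, warpedFrame, mlieBracket_prodField _ _ p (h _) (h _),
    mlieBracket_mulInvariantVectorField]

/-- The entries f'/f and -ff' are symmetric in the first two indices, matching the vanishing
brackets with ∂ₜ. What remains is the connection of g_G, which contains no f because a constant
rescaling of a metric does not change its connection. -/
theorem warpedChristoffel_torsion
    (hb₁₂ : ⁅e₁, e₂⁆ = α • e₂ + β • e₃) (hb₁₃ : ⁅e₁, e₃⁆ = (-β) • e₂ + δ • e₃)
    (hb₂₃ : ⁅e₂, e₃⁆ = 0) (t : ℝ) (i j : Fin 4) :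
    warpedChristoffel α β δ f t i j 0 - warpedChristoffel α β δ f t j i 0 = 0 ∧
    ∑ k : Fin 3, (warpedChristoffel α β δ f t i j k.succ -
      warpedChristoffel α β δ f t j i k.succ) • ![e₁, e₂, e₃] k =
        ⁅(Fin.cons 0 ![e₁, e₂, e₃] : Fin 4 → GroupLieAlgebra (𝓡 3) G) i,
          (Fin.cons 0 ![e₁, e₂, e₃] : Fin 4 → GroupLieAlgebra (𝓡 3) G) j⁆ := by
  have hb₂₁ : ⁅e₂, e₁⁆ = -(α • e₂ + β • e₃) := by rw [GroupLieAlgebra.bracket_swap, hb₁₂]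
  have hb₃₁ : ⁅e₃, e₁⁆ = -((-β) • e₂ + δ • e₃) := by rw [GroupLieAlgebra.bracket_swap, hb₁₃]
  have hb₃₂ : ⁅e₃, e₂⁆ = 0 := by rw [GroupLieAlgebra.bracket_swap, hb₂₃, neg_zero]
  fin_cases i <;> fin_cases j <;>
    simp [warpedChristoffel, Fin.sum_univ_three, hb₁₂, hb₁₃, hb₂₃, hb₂₁, hb₃₁, hb₃₂,
      GroupLieAlgebra.bracket_self, GroupLieAlgebra.zero_bracket, GroupLieAlgebra.bracket_zero,
      add_comm]

/-- The part coming from g_G is skew in the last two indices. The entries f'/f and -ff' cancel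
between ∂ₜ and each eᵢ, since f² · f'/f = ff', and on the diagonal f'/f produces (f²)' = 2ff'. -/
theorem warpedChristoffel_metric {t : ℝ} (ht : f t ≠ 0) (hf : DifferentiableAt ℝ f t)
    (i j k : Fin 4) :
    (if i = j then (Fin.cons 1 0 : Fin 4 → ℝ) k *
        deriv (fun t ↦ (Fin.cons 1 (fun _ ↦ f t ^ 2) : Fin 4 → ℝ) i) t else 0) =
      (Fin.cons 1 (fun _ ↦ f t ^ 2) : Fin 4 → ℝ) j * warpedChristoffel α β δ f t k i j +
      (Fin.cons 1 (fun _ ↦ f t ^ 2) : Fin 4 → ℝ) i * warpedChristoffel α β δ f t k j i := by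
  have h : deriv (fun t ↦ f t ^ 2) t = 2 * f t * deriv f t := by
    simp [deriv_fun_pow hf]
  have h2 (x : ℝ) : (Fin.cons 1 (fun _ ↦ x) : Fin 4 → ℝ) 2 = x := rfl
  have h3 (x : ℝ) : (Fin.cons 1 (fun _ ↦ x) : Fin 4 → ℝ) 3 = x := rfl
  have h2' : (Fin.cons 1 0 : Fin 4 → ℝ) 2 = 0 := rfl
  have h3' : (Fin.cons 1 0 : Fin 4 → ℝ) 3 = 0 := rfl
  fin_cases i <;> fin_cases j <;> fin_cases k <;>
    simp [warpedChristoffel, h, h2, h3, h2', h3'] <;> field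

theorem mvfderiv_fst_warpedFrame (p : ℝ × G) (i : Fin 4) :
    mvfderiv (𝓘(ℝ, ℝ).prod (𝓡 3)) (Prod.fst : ℝ × G → ℝ) p (warpedFrame e i p) =
      (Fin.cons 1 0 : Fin 4 → ℝ) i :=
  congrArg (fun A : ℝ × EuclideanSpace ℝ (Fin 3) →L[ℝ] ℝ ↦ A (warpedFrame e i p))
    (hasMFDerivAt_fst (I := 𝓘(ℝ, ℝ)) (I' := 𝓡 3) p).mfderiv

theorem isLeviCivitaOn_warpedMetric (hgG : gG.IsLeftInvariant)
    (he : ∀ i j, gG.inner 1 (![e₁, e₂, e₃] i) (![e₁, e₂, e₃] j) = if i = j then 1 else 0)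
    (hb₁₂ : ⁅e₁, e₂⁆ = α • e₂ + β • e₃) (hb₁₃ : ⁅e₁, e₃⁆ = (-β) • e₂ + δ • e₃)
    (hb₂₃ : ⁅e₂, e₃⁆ = 0) (hf : ∀ t ∈ J, DifferentiableAt ℝ f t) (hf₀ : ∀ t ∈ J, f t ≠ 0) :
    IsLeviCivitaOn (𝓘(ℝ, ℝ).prod (𝓡 3)) (warpedMetric f gG) (J ×ˢ (Set.univ : Set G))
      (frameConnection (warpedFrame ![e₁, e₂, e₃]) (warpedCoframe gG ![e₁, e₂, e₃])
        (christoffelForm (warpedFrame ![e₁, e₂, e₃]) (warpedCoframe gG ![e₁, e₂, e₃])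
          (warpedChristoffel α β δ f) Prod.fst)) := by
  have h := isDualFrame_warpedFrame hgG he
  have hm : ∀ i, ∀ t ∈ J,
      DifferentiableAt ℝ (fun t ↦ (Fin.cons 1 (fun _ ↦ f t ^ 2) : Fin 4 → ℝ) i) t := by
    intro i t ht
    cases i using Fin.cases with
    | zero => simp
    | succ i => simpa using (hf t ht).fun_pow 2
  rw [warpedMetric_eq_diagonalMetric hgG he]
  refine h.isLeviCivitaOn_frameConnection (fun i p hp ↦ ?_) (fun p hp i j ↦ ?_)
    fun p hp i j k ↦ ?_
  · exact (hm i p.1 hp.1).mdifferentiableAt.comp p mdifferentiableAt_fst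
  · obtain ⟨h1, h2⟩ := warpedChristoffel_torsion (f := f) hb₁₂ hb₁₃ hb₂₃ p.1 i j
    rw [h.christoffelForm_apply, h.christoffelForm_apply, ← Finset.sum_sub_distrib]
    simp only [← sub_smul]
    rw [sum_smul_warpedFrame, mlieBracket_warpedFrame, h1, h2]
  · rw [h.coframe_christoffelForm_apply, h.coframe_christoffelForm_apply,
      ← warpedChristoffel_metric (hf₀ p.1 hp.1) (hf p.1 hp.1),
      mvfderiv_comp_real (hm i p.1 hp.1) mdifferentiableAt_fst, mvfderiv_fst_warpedFrame]

end WarpedConnection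

/-! ### The rough Laplacian of φ∂ₜ + V₂ in closed form. -/

section WarpedLaplacian

open VectorField

variable {G : Type*} [TopologicalSpace G] [ChartedSpace (EuclideanSpace ℝ (Fin 3)) G] [Group G]
  [LieGroup (𝓡 3) ∞ G]
  {gG : SmoothMetric G} {e₁ e₂ e₃ : GroupLieAlgebra (𝓡 3) G} {α β δ a b c : ℝ} {f φ : ℝ → ℝ}
  {J : Set ℝ}

theorem warpedField_eq_sum (p : ℝ × G) :
    warpedField φ (a • e₁ + b • e₂ + c • e₃) p =
      ∑ j, (![φ p.1, a, b, c] : Fin 4 → ℝ) j • warpedFrame ![e₁, e₂, e₃] j p := by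
  rw [sum_smul_warpedFrame]
  simp [Fin.sum_univ_three]
  rfl

/-- The components in the frame `warpedFrame ![e₁, e₂, e₃]` of the covariant derivatives of
`warpedField φ (a • e₁ + b • e₂ + c • e₃)` along the fields of that frame. -/
def warpedGradient (α β δ a b c : ℝ) (f φ : ℝ → ℝ) (t : ℝ) : Fin 4 → Fin 4 → ℝ :=
  ![![deriv φ t, deriv f t / f t * a, deriv f t / f t * b, deriv f t / f t * c],
    ![-(f t * deriv f t) * a, deriv f t / f t * φ t, -β * c, β * b],
    ![-(f t * deriv f t) * b, α * b, deriv f t / f t * φ t - α * a, 0],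
    ![-(f t * deriv f t) * c, δ * c, 0, deriv f t / f t * φ t - δ * a]]

/-- The components in the frame `warpedFrame ![e₁, e₂, e₃]` of the rough Laplacian of
`warpedField φ (a • e₁ + b • e₂ + c • e₃)`. -/
def warpedLaplacian (α β δ a b c : ℝ) (f φ : ℝ → ℝ) (t : ℝ) : Fin 4 → ℝ :=
  ![-(deriv (deriv φ) t + 3 * (deriv f t / f t) * deriv φ t - 3 * (deriv f t / f t) ^ 2 * φ t
      + 2 * a * (α + δ) * (deriv f t / f t)),
    (a * (α ^ 2 + δ ^ 2) - (f t * deriv (deriv f) t + 2 * deriv f t ^ 2) * a) / f t ^ 2,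
    (b * (β ^ 2 + α ^ 2) - c * β * (α + δ) - (f t * deriv (deriv f) t + 2 * deriv f t ^ 2) * b)
      / f t ^ 2,
    (c * (β ^ 2 + δ ^ 2) + b * β * (α + δ) - (f t * deriv (deriv f) t + 2 * deriv f t ^ 2) * c)
      / f t ^ 2]

theorem warpedGradient_eq (t : ℝ) (i k : Fin 4) :
    (Fin.cons 1 0 : Fin 4 → ℝ) i * deriv (fun t ↦ (![φ t, a, b, c] : Fin 4 → ℝ) k) t +
      ∑ j, (![φ t, a, b, c] : Fin 4 → ℝ) j * warpedChristoffel α β δ f t i j k =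
      warpedGradient α β δ a b c f φ t i k := by
  have h2' : (Fin.cons 1 0 : Fin 4 → ℝ) 2 = 0 := rfl
  have h3' : (Fin.cons 1 0 : Fin 4 → ℝ) 3 = 0 := rfl
  fin_cases i <;> fin_cases k <;>
    simp [warpedChristoffel, warpedGradient, Fin.sum_univ_four, h2', h3'] <;> ring

theorem warpedLaplacian_eq {t : ℝ} (ht : f t ≠ 0) (hf : DifferentiableAt ℝ f t)
    (hf' : DifferentiableAt ℝ (deriv f) t) (l : Fin 4) :
    ∑ i, ((Fin.cons 1 (fun _ ↦ f t ^ 2) : Fin 4 → ℝ) i)⁻¹ *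
      (∑ k, warpedChristoffel α β δ f t i i k * warpedGradient α β δ a b c f φ t k l -
        ((Fin.cons 1 0 : Fin 4 → ℝ) i * deriv (fun t ↦ warpedGradient α β δ a b c f φ t i l) t +
          ∑ j, warpedGradient α β δ a b c f φ t i j * warpedChristoffel α β δ f t i j l)) =
      warpedLaplacian α β δ a b c f φ t l := by
  have h (x : ℝ) : deriv (fun t ↦ deriv f t / f t * x) t =
      (deriv (deriv f) t * f t - deriv f t * deriv f t) / f t ^ 2 * x := by
    rw [deriv_mul_const (hf'.fun_div hf ht), deriv_fun_div hf' hf ht]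
  simp only [Fin.sum_univ_four (f := fun i ↦ ((Fin.cons 1 (fun _ ↦ f t ^ 2) : Fin 4 → ℝ) i)⁻¹ * _)]
  have h2 (x : ℝ) : (Fin.cons 1 (fun _ ↦ x) : Fin 4 → ℝ) 2 = x := rfl
  have h3 (x : ℝ) : (Fin.cons 1 (fun _ ↦ x) : Fin 4 → ℝ) 3 = x := rfl
  have h2' : (Fin.cons 1 0 : Fin 4 → ℝ) 2 = 0 := rfl
  have h3' : (Fin.cons 1 0 : Fin 4 → ℝ) 3 = 0 := rfl
  fin_cases l <;>
    simp [warpedChristoffel, warpedGradient, warpedLaplacian, Fin.sum_univ_four, h, h2, h3, h2',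
      h3'] <;> field_simp <;> ring

theorem differentiableAt_warpedGradient {t : ℝ} (ht : f t ≠ 0) (hf : DifferentiableAt ℝ f t)
    (hf' : DifferentiableAt ℝ (deriv f) t) (hφ : DifferentiableAt ℝ φ t)
    (hφ' : DifferentiableAt ℝ (deriv φ) t) (i k : Fin 4) :
    DifferentiableAt ℝ (fun t ↦ warpedGradient α β δ a b c f φ t i k) t := by
  fin_cases i <;> fin_cases k <;> simp [warpedGradient] <;> fun_prop (disch := assumption)

theorem differentiableAt_deriv_of_contDiffOn {g : ℝ → ℝ} (hJ : IsOpen J) (hg : ContDiffOn ℝ ∞ g J)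
    {t : ℝ} (ht : t ∈ J) : DifferentiableAt ℝ (deriv g) t :=
  ((hg.deriv_of_isOpen (m := 1) hJ (by norm_cast)).differentiableOn (by simp)).differentiableAt
    (hJ.mem_nhds ht)

theorem differentiableAt_of_contDiffOn {g : ℝ → ℝ} (hJ : IsOpen J) (hg : ContDiffOn ℝ ∞ g J)
    {t : ℝ} (ht : t ∈ J) : DifferentiableAt ℝ g t :=
  (hg.differentiableOn (by simp)).differentiableAt (hJ.mem_nhds ht)

theorem roughLaplacian_warpedField (hgG : gG.IsLeftInvariant)
    (he : ∀ i j, gG.inner 1 (![e₁, e₂, e₃] i) (![e₁, e₂, e₃] j) = if i = j then 1 else 0)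
    (hb₁₂ : ⁅e₁, e₂⁆ = α • e₂ + β • e₃) (hb₁₃ : ⁅e₁, e₃⁆ = (-β) • e₂ + δ • e₃)
    (hb₂₃ : ⁅e₂, e₃⁆ = 0) (hJ : IsOpen J) (hf : ContDiffOn ℝ ∞ f J) (hf₀ : ∀ t ∈ J, f t ≠ 0)
    (hφ : ContDiffOn ℝ ∞ φ J)
    {cov : (∀ p : ℝ × G, TangentSpace (𝓘(ℝ, ℝ).prod (𝓡 3)) p) →
      ∀ p : ℝ × G, TangentSpace (𝓘(ℝ, ℝ).prod (𝓡 3)) p →L[ℝ]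
        TangentSpace (𝓘(ℝ, ℝ).prod (𝓡 3)) p}
    (hcov : IsLeviCivitaOn (𝓘(ℝ, ℝ).prod (𝓡 3)) (warpedMetric f gG)
      (J ×ˢ (Set.univ : Set G)) cov) {N : Set (ℝ × G)}
    {u : Fin (Module.finrank ℝ (ℝ × EuclideanSpace ℝ (Fin 3))) →
      ∀ p : ℝ × G, TangentSpace (𝓘(ℝ, ℝ).prod (𝓡 3)) p}
    (hu : IsOrthonormalFrameOn (𝓘(ℝ, ℝ).prod (𝓡 3)) (warpedMetric f gG) N u)
    {p : ℝ × G} (hN : N ∈ nhds p) (hp : p.1 ∈ J) :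
    roughLaplacian (𝓘(ℝ, ℝ).prod (𝓡 3)) cov u (warpedField φ (a • e₁ + b • e₂ + c • e₃)) p =
      ∑ l, warpedLaplacian α β δ a b c f φ p.1 l • warpedFrame ![e₁, e₂, e₃] l p := by
  have h := isDualFrame_warpedFrame hgG he
  have hfd : ∀ t ∈ J, DifferentiableAt ℝ f t := fun t ↦ differentiableAt_of_contDiffOn hJ hf
  have hΓ := isLeviCivitaOn_warpedMetric hgG he hb₁₂ hb₁₃ hb₂₃ hfd hf₀
  rw [warpedMetric_eq_diagonalMetric hgG he] at hcov hu hΓ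
  rw [h.roughLaplacian_sum_smul (c := fun j t ↦ ![φ t, a, b, c] j)
    (A := fun i k t ↦ warpedGradient α β δ a b c f φ t i k) (by simp) (hJ.prod isOpen_univ)
    hcov hΓ hu hN ⟨hp, trivial⟩ ?_ (fun q ↦ mdifferentiableAt_fst) mvfderiv_fst_warpedFrame
    (funext warpedField_eq_sum) ?_ (fun i k q _ ↦ warpedGradient_eq q.1 i k)
    (differentiableAt_warpedGradient (hf₀ _ hp) (hfd _ hp)
      (differentiableAt_deriv_of_contDiffOn hJ hf hp) (differentiableAt_of_contDiffOn hJ hφ hp)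
      (differentiableAt_deriv_of_contDiffOn hJ hφ hp))]
  · simp only [warpedLaplacian_eq (hf₀ _ hp) (hfd _ hp)
      (differentiableAt_deriv_of_contDiffOn hJ hf hp)]
  · intro i q hq
    cases i using Fin.cases with
    | zero => simp
    | succ i => simpa using hf₀ _ hq.1
  · intro j q hq
    have := differentiableAt_of_contDiffOn hJ hφ hq.1
    fin_cases j <;> simp [this]

end WarpedLaplacian

/-! ### Harmonicity as four scalar equations in t. -/

section WarpedHarmonic

variable {G : Type*} [TopologicalSpace G] [ChartedSpace (EuclideanSpace ℝ (Fin 3)) G] [Group G]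
  [LieGroup (𝓡 3) ∞ G]
  {gG : SmoothMetric G} {e₁ e₂ e₃ : GroupLieAlgebra (𝓡 3) G} {α β δ a b c : ℝ} {f φ : ℝ → ℝ}
  {J : Set ℝ}

/-- The frame ∂ₜ, eᵢ/f. Its existence keeps the condition over all orthonormal frames from being
vacuous, so that equations can be extracted from harmonicity. -/
theorem exists_isOrthonormalFrameOn_warpedMetric {e : Fin 3 → GroupLieAlgebra (𝓡 3) G}
    (hgG : gG.IsLeftInvariant)
    (he : ∀ i j, gG.inner 1 (e i) (e j) = if i = j then 1 else 0)
    (hf : ContDiffOn ℝ ∞ f J) (hf₀ : ∀ t ∈ J, f t ≠ 0) :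
    ∃ u : Fin (Module.finrank ℝ (ℝ × EuclideanSpace ℝ (Fin 3))) →
      ∀ p : ℝ × G, TangentSpace (𝓘(ℝ, ℝ).prod (𝓡 3)) p,
    IsOrthonormalFrameOn (𝓘(ℝ, ℝ).prod (𝓡 3)) (warpedMetric f gG)
      (J ×ˢ (Set.univ : Set G)) u := by
  have h := isDualFrame_warpedFrame hgG he
  have hn : Module.finrank ℝ (ℝ × EuclideanSpace ℝ (Fin 3)) = 4 := by simp
  let s : Fin 4 → ℝ → ℝ := fun k t ↦ (Fin.cons 1 (fun _ ↦ (f t)⁻¹) : Fin 4 → ℝ) k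
  have hs : ∀ k, ContDiffOn ℝ ∞ (s k) J := by
    intro k
    cases k using Fin.cases with
    | zero => simpa [s] using contDiffOn_const
    | succ k => exact hf.inv hf₀
  refine ⟨fun i p ↦ s (finCongr hn i) p.1 • warpedFrame e (finCongr hn i) p, fun i ↦ ?_,
    fun p hp i j ↦ ?_⟩
  · have h1 : ContMDiffOn (𝓘(ℝ, ℝ).prod (𝓡 3)) 𝓘(ℝ, ℝ) ∞
        (fun q : ℝ × G ↦ s (finCongr hn i) q.1) (J ×ˢ (Set.univ : Set G)) :=
      (hs _).contMDiffOn.comp contMDiff_fst.contMDiffOn fun q hq ↦ hq.1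
    exact h1.smul_section (contMDiff_warpedFrame _).contMDiffOn
  · have h1 : ∀ k, (Fin.cons 1 (fun _ ↦ f p.1 ^ 2) : Fin 4 → ℝ) k * (s k p.1 * s k p.1) = 1 := by
      intro k
      have := hf₀ p.1 hp.1
      cases k using Fin.cases with
      | zero => simp [s]
      | succ k => simp [s]; field
    rw [warpedMetric_eq_diagonalMetric hgG he, diagonalMetric_smul_left, diagonalMetric_comm,
      diagonalMetric_smul_left, h.diagonalMetric_apply_frame, h.coframe_apply]
    by_cases hij : i = j
    · subst hij
      simp only [if_true]
      linarith [h1 (finCongr hn i)]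
    · simp [hij]

theorem isHarmonicVectorFieldOn_warpedField_iff (hgG : gG.IsLeftInvariant)
    (he : ∀ i j, gG.inner 1 (![e₁, e₂, e₃] i) (![e₁, e₂, e₃] j) = if i = j then 1 else 0)
    (hb₁₂ : ⁅e₁, e₂⁆ = α • e₂ + β • e₃) (hb₁₃ : ⁅e₁, e₃⁆ = (-β) • e₂ + δ • e₃)
    (hb₂₃ : ⁅e₂, e₃⁆ = 0) (hJ : IsOpen J) (hf : ContDiffOn ℝ ∞ f J) (hf₀ : ∀ t ∈ J, f t ≠ 0)
    (hφ : ContDiffOn ℝ ∞ φ J) :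
    IsHarmonicVectorFieldOn (𝓘(ℝ, ℝ).prod (𝓡 3)) (warpedMetric f gG) (J ×ˢ (Set.univ : Set G))
      (warpedField φ (a • e₁ + b • e₂ + c • e₃)) ↔
    ∀ t ∈ J, ∀ l, warpedLaplacian α β δ a b c f φ t l = 0 := by
  have h := isDualFrame_warpedFrame hgG he
  have hΩ : IsOpen (J ×ˢ (Set.univ : Set G)) := hJ.prod isOpen_univ
  constructor
  · rintro ⟨-, cov, hcov, hlap⟩ t ht l
    obtain ⟨u, hu⟩ := exists_isOrthonormalFrameOn_warpedMetric hgG he hf hf₀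
    -- The components depend on t only, so any point of `G` would serve.
    have hp : ((t, 1) : ℝ × G) ∈ J ×ˢ (Set.univ : Set G) := ⟨ht, trivial⟩
    have h1 := hlap _ subset_rfl hΩ u hu _ hp
    rw [roughLaplacian_warpedField hgG he hb₁₂ hb₁₃ hb₂₃ hJ hf hf₀ hφ hcov hu (hΩ.mem_nhds hp) ht]
      at h1
    have h2 := congrArg (warpedCoframe gG ![e₁, e₂, e₃] l (t, 1)) h1
    rwa [h.coframe_sum_smul, map_zero] at h2
  · intro hlap
    refine ⟨contMDiffOn_prodField hφ (contMDiff_infty_mulInvariantVectorField _), _,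
      isLeviCivitaOn_warpedMetric hgG he hb₁₂ hb₁₃ hb₂₃
        (fun t ↦ differentiableAt_of_contDiffOn hJ hf) hf₀, fun N hNΩ hN u hu p hp ↦ ?_⟩
    rw [roughLaplacian_warpedField hgG he hb₁₂ hb₁₃ hb₂₃ hJ hf hf₀ hφ
      (isLeviCivitaOn_warpedMetric hgG he hb₁₂ hb₁₃ hb₂₃
        (fun t ↦ differentiableAt_of_contDiffOn hJ hf) hf₀) hu (hN.mem_nhds hp) (hNΩ hp).1]
    simp [hlap p.1 (hNΩ hp).1]

end WarpedHarmonic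

/-! ### The constant ε and the classification of eigenvectors. -/

section HarmonicEquations

/-- `V₂ = a e₁ + b e₂ + c e₃` satisfies `∇*∇V₂ = ε V₂` on `G`. -/
def IsLaplacianEigenvector (α β δ a b c ε : ℝ) : Prop :=
  a * (α ^ 2 + δ ^ 2) = ε * a ∧ b * (β ^ 2 + α ^ 2) - c * β * (α + δ) = ε * b ∧
    c * (β ^ 2 + δ ^ 2) + b * β * (α + δ) = ε * c

variable {α β δ a b c ε : ℝ} {f φ : ℝ → ℝ} {J : Set ℝ}

theorem forall_warpedLaplacian_eq_zero_iff (hJ : J.Nonempty) (hf : ∀ t ∈ J, f t ≠ 0)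
    (habc : a ^ 2 + b ^ 2 + c ^ 2 = 1) :
    (∀ t ∈ J, ∀ l, warpedLaplacian α β δ a b c f φ t l = 0) ↔
      ∃ ε : ℝ, (∀ t ∈ J, f t * deriv (deriv f) t + 2 * (deriv f t) ^ 2 = ε) ∧
        (∀ t ∈ J, deriv (deriv φ) t + 3 * (deriv f t / f t) * deriv φ t
            - 3 * (deriv f t / f t) ^ 2 * φ t = -2 * a * (α + δ) * (deriv f t / f t)) ∧
        IsLaplacianEigenvector α β δ a b c ε := by
  have key : ∀ t ∈ J, (∀ l, warpedLaplacian α β δ a b c f φ t l = 0) ↔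
      (deriv (deriv φ) t + 3 * (deriv f t / f t) * deriv φ t
        - 3 * (deriv f t / f t) ^ 2 * φ t = -2 * a * (α + δ) * (deriv f t / f t)) ∧
      IsLaplacianEigenvector α β δ a b c (f t * deriv (deriv f) t + 2 * (deriv f t) ^ 2) := by
    intro t ht
    have h2 := pow_ne_zero 2 (hf t ht)
    simp only [Fin.forall_fin_succ, warpedLaplacian, IsLaplacianEigenvector]
    simp [h2, -neg_add_rev, sub_eq_zero]
    intros
    constructor <;> intro h <;> linarith
  constructor
  · intro h
    -- The witness is the inner product of LV₂ with V₂. Pairing the eigenvector equations at t with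
    -- the unit vector (a, b, c) shows that ff'' + 2f'² takes this value at every t.
    refine ⟨a * (a * (α ^ 2 + δ ^ 2)) + b * (b * (β ^ 2 + α ^ 2) - c * β * (α + δ)) +
      c * (c * (β ^ 2 + δ ^ 2) + b * β * (α + δ)), ?_⟩
    have h1 : ∀ t ∈ J, f t * deriv (deriv f) t + 2 * (deriv f t) ^ 2 =
        a * (a * (α ^ 2 + δ ^ 2)) + b * (b * (β ^ 2 + α ^ 2) - c * β * (α + δ)) +
        c * (c * (β ^ 2 + δ ^ 2) + b * β * (α + δ)) := by
      intro t ht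
      obtain ⟨-, h1, h2, h3⟩ := (key t ht).1 (h t ht)
      linear_combination -(f t * deriv (deriv f) t + 2 * (deriv f t) ^ 2) * habc - a * h1 -
        b * h2 - c * h3
    -- One point of `J` is needed to transfer the eigenvector equations to the constant.
    obtain ⟨t, ht⟩ := hJ
    exact ⟨h1, fun t ht ↦ ((key t ht).1 (h t ht)).1, h1 t ht ▸ ((key t ht).1 (h t ht)).2⟩
  · rintro ⟨ε, h1, h2, h3⟩ t ht
    exact (key t ht).2 ⟨h2 t ht, (h1 t ht).symm ▸ h3⟩

/-- Since (f³)'' = 3f(ff'' + 2f'²) = 0, the function f³ is affine on the interval. -/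
theorem exists_eq_affine_rpow (hJ : IsOpen J) (hJ' : J.OrdConnected) (hf : ContDiffOn ℝ ∞ f J)
    (hf_pos : ∀ t ∈ J, 0 < f t)
    (h : ∀ t ∈ J, f t * deriv (deriv f) t + 2 * (deriv f t) ^ 2 = 0) :
    ∃ c₁ c₂ : ℝ, ∀ t ∈ J, 0 < c₁ * t + c₂ ∧ f t = (c₁ * t + c₂) ^ (1 / 3 : ℝ) := by
  have hd : ∀ t ∈ J, HasDerivAt (fun t ↦ f t ^ 3) (3 * f t ^ 2 * deriv f t) t := fun t ht ↦ by
    simpa using (differentiableAt_of_contDiffOn hJ hf ht).hasDerivAt.fun_pow 3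
  have hd' : ∀ t ∈ J, HasDerivAt (fun t ↦ 3 * f t ^ 2 * deriv f t) 0 t := fun t ht ↦ by
    refine ((((differentiableAt_of_contDiffOn hJ hf ht).hasDerivAt.fun_pow 2).const_mul 3).fun_mul
      (differentiableAt_deriv_of_contDiffOn hJ hf ht).hasDerivAt).congr_deriv ?_
    simp only [Nat.cast_ofNat, Nat.add_one_sub_one, pow_one]
    linear_combination 3 * f t * h t ht
  obtain ⟨c₁, hc₁⟩ := hJ.exists_is_const_of_deriv_eq_zero hJ'.isPreconnected
    (fun t ht ↦ (hd' t ht).differentiableAt.differentiableWithinAt) fun t ht ↦ (hd' t ht).deriv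
  have hd'' : ∀ t ∈ J, HasDerivAt (fun t ↦ f t ^ 3 - c₁ * t) 0 t := fun t ht ↦ by
    refine ((hd t ht).fun_sub ((hasDerivAt_id t).const_mul c₁)).congr_deriv ?_
    rw [hc₁ t ht]
    ring
  obtain ⟨c₂, hc₂⟩ := hJ.exists_is_const_of_deriv_eq_zero hJ'.isPreconnected
    (fun t ht ↦ (hd'' t ht).differentiableAt.differentiableWithinAt) fun t ht ↦ (hd'' t ht).deriv
  refine ⟨c₁, c₂, fun t ht ↦ ?_⟩
  have h3 : c₁ * t + c₂ = f t ^ 3 := by linarith [hc₂ t ht]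
  have hp := hf_pos t ht
  refine ⟨h3 ▸ pow_pos hp 3, ?_⟩
  rw [h3, ← Real.rpow_natCast, ← Real.rpow_mul hp.le]
  norm_num

/-- The combination b·(third equation) - c·(second equation) eliminates ε and has the factor α + δ.
-/
theorem IsLaplacianEigenvector.mul_eq (h : IsLaplacianEigenvector α β δ a b c ε)
    (hαδ : 0 < α + δ) : (b ^ 2 + c ^ 2) * β = b * c * (α - δ) := by
  obtain ⟨-, h2, h3⟩ := h
  refine mul_right_cancel₀ hαδ.ne' ?_
  linear_combination b * h3 - c * h2

theorem isLaplacianEigenvector_iff_of_ne_zero (ha : a ≠ 0) :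
    IsLaplacianEigenvector α β δ a b c ε ↔ ε = α ^ 2 + δ ^ 2 ∧
      b * (β ^ 2 - δ ^ 2) = β * (α + δ) * c ∧ c * (β ^ 2 - α ^ 2) = -β * (α + δ) * b := by
  constructor
  · rintro ⟨h1, h2, h3⟩
    have hε : ε = α ^ 2 + δ ^ 2 := mul_right_cancel₀ ha (by linarith)
    subst hε
    exact ⟨rfl, by linarith, by linarith⟩
  · rintro ⟨rfl, h2, h3⟩
    exact ⟨by ring, by linarith, by linarith⟩

theorem isLaplacianEigenvector_zero_iff (hαδ : 0 < α + δ) (hbc : b ^ 2 + c ^ 2 = 1) :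
    IsLaplacianEigenvector α β δ 0 b c ε ↔
      β = b * c * (α - δ) ∧ ε = β ^ 2 + b ^ 2 * α ^ 2 + c ^ 2 * δ ^ 2 := by
  constructor
  · intro h
    refine ⟨by simpa [hbc] using h.mul_eq hαδ, ?_⟩
    obtain ⟨-, h2, h3⟩ := h
    linear_combination (β ^ 2 - ε) * hbc - b * h2 - c * h3
  · rintro ⟨rfl, rfl⟩
    refine ⟨by ring, ?_, ?_⟩
    · linear_combination (-b * α ^ 2) * hbc
    · linear_combination (-c * δ ^ 2) * hbc

/-- `P` stands for the explicit form of f in the case ε = 0. Being a consequence of ε = 0, it can be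
inserted into that case without changing the truth of the list. -/
theorem isLaplacianEigenvector_iff (hαδ_pos : 0 < α + δ) (hαδ : δ ≤ α)
    (habc : a ^ 2 + b ^ 2 + c ^ 2 = 1) {P : Prop} (hP : ε = 0 → P) :
    IsLaplacianEigenvector α β δ a b c ε ↔
      ((α = δ ∧ 0 < δ ∧
          ((ε = 2 * α ^ 2 ∧ (a = 1 ∨ a = -1) ∧ b = 0 ∧ c = 0) ∨
           (β = 0 ∧ ε = α ^ 2 ∧
              ((a = 0 ∧ (b = 1 ∨ b = -1) ∧ c = 0) ∨ (a = 0 ∧ b = 0 ∧ (c = 1 ∨ c = -1)))) ∨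
           (β = 0 ∧ ε = α ^ 2 + β ^ 2 ∧ a = 0 ∧ b ≠ 0 ∧ c ≠ 0 ∧ b ^ 2 + c ^ 2 = 1))) ∨
       (((δ < α ∧ 0 < δ) ∨ (0 < α ∧ δ < 0)) ∧
          ((ε = α ^ 2 + δ ^ 2 ∧ a ≠ 0 ∧ a ^ 2 + b ^ 2 + c ^ 2 = 1 ∧
              b * (β ^ 2 - δ ^ 2) = β * (α + δ) * c ∧
              c * (β ^ 2 - α ^ 2) = -β * (α + δ) * b) ∨
           (β = 0 ∧ ε = δ ^ 2 ∧ a = 0 ∧ b = 0 ∧ (c = 1 ∨ c = -1)) ∨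
           (β = 0 ∧ ε = α ^ 2 ∧ a = 0 ∧ (b = 1 ∨ b = -1) ∧ c = 0) ∨
           (β = b * c * (α - δ) ∧ ε = β ^ 2 + b ^ 2 * α ^ 2 + c ^ 2 * δ ^ 2 ∧
              a = 0 ∧ b ≠ 0 ∧ c ≠ 0 ∧ b ^ 2 + c ^ 2 = 1))) ∨
       (δ < α ∧ δ = 0 ∧
          ((β = 0 ∧ ε = 0 ∧ P ∧ a = 0 ∧ b = 0 ∧ (c = 1 ∨ c = -1)) ∨
           (β = 0 ∧ ε = α ^ 2 ∧ a = 0 ∧ (b = 1 ∨ b = -1) ∧ c = 0) ∨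
           (β = b * c * α ∧ ε = β ^ 2 + b ^ 2 * α ^ 2 ∧
              a = 0 ∧ b ≠ 0 ∧ c ≠ 0 ∧ b ^ 2 + c ^ 2 = 1) ∨
           (ε = α ^ 2 ∧ (a = 1 ∨ a = -1) ∧ b = 0 ∧ c = 0) ∨
           (β = 0 ∧ ε = α ^ 2 ∧ a ≠ 0 ∧ c = 0 ∧ a ^ 2 + b ^ 2 = 1)))) := by
  have hα : 0 < α := by linarith
  have hδ : α = δ ∧ 0 < δ ∨ ((δ < α ∧ 0 < δ) ∨ (0 < α ∧ δ < 0)) ∨ δ < α ∧ δ = 0 := by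
    rcases hαδ.eq_or_lt with rfl | hlt
    · exact Or.inl ⟨rfl, hα⟩
    · rcases lt_trichotomy δ 0 with h | h | h <;> simp [*]
  -- Replacing each choice of sign by an equation for a square lets linear arithmetic derive it from
  -- the unit norm.
  simp only [← sq_eq_one_iff]
  constructor
  · intro h
    by_cases ha : a = 0
    · subst ha
      have hbc : b ^ 2 + c ^ 2 = 1 := by linarith
      obtain ⟨hβ, hε⟩ := (isLaplacianEigenvector_zero_iff hαδ_pos hbc).1 h
      rcases hδ with ⟨rfl, hδ⟩ | hδ | ⟨hlt, rfl⟩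
      · have hβ0 : β = 0 := by linarith
        have hε' : ε = α ^ 2 := by rw [hε, hβ0]; linear_combination α ^ 2 * hbc
        refine Or.inl ⟨rfl, hδ, Or.inr ?_⟩
        by_cases hb : b = 0
        · exact Or.inl ⟨hβ0, hε', Or.inr ⟨rfl, hb, by simpa [hb] using hbc⟩⟩
        by_cases hc : c = 0
        · exact Or.inl ⟨hβ0, hε', Or.inl ⟨rfl, by simpa [hc] using hbc, hc⟩⟩
        · exact Or.inr ⟨hβ0, by rw [hε', hβ0]; ring, rfl, hb, hc, hbc⟩
      · refine Or.inr (Or.inl ⟨hδ, Or.inr ?_⟩)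
        by_cases hb : b = 0
        · subst hb
          have hc : c ^ 2 = 1 := by linarith
          have hβ0 : β = 0 := by linarith
          exact Or.inl ⟨hβ0, by rw [hε, hβ0, hc]; ring, rfl, rfl, hc⟩
        by_cases hc : c = 0
        · subst hc
          have hb' : b ^ 2 = 1 := by linarith
          have hβ0 : β = 0 := by linarith
          exact Or.inr (Or.inl ⟨hβ0, by rw [hε, hβ0, hb']; ring, rfl, hb', rfl⟩)
        · exact Or.inr (Or.inr ⟨hβ, hε, rfl, hb, hc, hbc⟩)
      · refine Or.inr (Or.inr ⟨hlt, rfl, ?_⟩)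
        by_cases hb : b = 0
        · subst hb
          have hβ0 : β = 0 := by linarith
          have hε' : ε = 0 := by rw [hε, hβ0]; ring
          exact Or.inl ⟨hβ0, hε', hP hε', rfl, rfl, by linarith⟩
        by_cases hc : c = 0
        · subst hc
          have hb' : b ^ 2 = 1 := by linarith
          have hβ0 : β = 0 := by linarith
          exact Or.inr (Or.inl ⟨hβ0, by rw [hε, hβ0, hb']; ring, rfl, hb', rfl⟩)
        · exact Or.inr (Or.inr (Or.inl ⟨by linarith, by linarith, rfl, hb, hc, hbc⟩))
    · obtain ⟨hε, h2, h3⟩ := (isLaplacianEigenvector_iff_of_ne_zero ha).1 h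
      have hK := h.mul_eq hαδ_pos
      rcases hδ with ⟨rfl, hδ⟩ | hδ | ⟨hlt, rfl⟩
      -- For α = δ the relation `hK` reads (b² + c²)β = 0; if β = 0, then `h2` and `h3` become bα² =
      -- 0 and cα² = 0.
      · have hbc : b = 0 ∧ c = 0 := by
          have h0 : (b ^ 2 + c ^ 2) * β = 0 := by linarith
          rcases mul_eq_zero.1 h0 with h0 | h0
          · exact ⟨by nlinarith, by nlinarith⟩
          · subst h0
            have hα2 : α ^ 2 ≠ 0 := by positivity
            exact ⟨mul_right_cancel₀ hα2 (by linarith), mul_right_cancel₀ hα2 (by linarith)⟩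
        obtain ⟨rfl, rfl⟩ := hbc
        exact Or.inl ⟨rfl, hδ, Or.inl ⟨by linarith, by linarith, rfl, rfl⟩⟩
      · exact Or.inr (Or.inl ⟨hδ, Or.inl ⟨hε, ha, habc, h2, h3⟩⟩)
      · refine Or.inr (Or.inr ⟨hlt, rfl, Or.inr (Or.inr (Or.inr ?_))⟩)
        have hε' : ε = α ^ 2 := by linarith
        -- For β = δ = 0 the eigenvalue α² is shared by e₁ and e₂, so b stays free and only c must
        -- vanish. For β ≠ 0 the two equations give bβ = αc and then cβ² = 0, leaving ±e₁.
        by_cases hβ : β = 0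
        · subst hβ
          have hc : c = 0 := mul_right_cancel₀ (pow_ne_zero 2 hα.ne') (by linarith)
          subst hc
          exact Or.inr ⟨rfl, hε', ha, rfl, by linarith⟩
        · have h2' : b * β = α * c := mul_right_cancel₀ hβ (by linarith)
          have hc : c = 0 := mul_right_cancel₀ (pow_ne_zero 2 hβ)
            (by linear_combination h3 - α * h2')
          subst hc
          have hb : b = 0 := mul_right_cancel₀ hβ (by linarith)
          subst hb
          exact Or.inl ⟨hε', by linarith, rfl, rfl⟩
  · have h0 := isLaplacianEigenvector_zero_iff (b := b) (c := c) (β := β) (ε := ε) hαδ_pos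
    rintro (⟨rfl, -, ⟨rfl, -, rfl, rfl⟩ | ⟨rfl, rfl, ⟨rfl, hb, rfl⟩ | ⟨rfl, rfl, hc⟩⟩ |
      ⟨rfl, rfl, rfl, -, -, hbc⟩⟩ | ⟨-, ⟨hε, ha, -, h2, h3⟩ | ⟨rfl, rfl, rfl, rfl, hc⟩ |
      ⟨rfl, rfl, rfl, hb, rfl⟩ | ⟨hβ, hε, rfl, -, -, hbc⟩⟩ |
      ⟨-, rfl, ⟨rfl, rfl, -, rfl, rfl, hc⟩ | ⟨rfl, rfl, rfl, hb, rfl⟩ |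
        ⟨hβ, hε, rfl, -, -, hbc⟩ | ⟨rfl, -, rfl, rfl⟩ | ⟨rfl, rfl, -, rfl, -⟩⟩)
    · exact ⟨by ring, by ring, by ring⟩
    · exact ⟨by ring, by ring, by ring⟩
    · exact ⟨by ring, by ring, by ring⟩
    · exact ⟨by ring, by ring, by ring⟩
    · exact (isLaplacianEigenvector_iff_of_ne_zero ha).2 ⟨hε, h2, h3⟩
    · exact ⟨by ring, by ring, by ring⟩
    · exact ⟨by ring, by ring, by ring⟩
    · exact (h0 hbc).2 ⟨hβ, hε⟩
    · exact ⟨by ring, by ring, by ring⟩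
    · exact ⟨by ring, by ring, by ring⟩
    · exact (h0 hbc).2 ⟨by linarith, by linarith⟩
    · exact ⟨by ring, by ring, by ring⟩
    · exact ⟨by ring, by ring, by ring⟩

end HarmonicEquations

end

/-! ### The main theorem. -/

theorem mainTheorem3
    {G : Type*} [TopologicalSpace G] [ChartedSpace (EuclideanSpace ℝ (Fin 3)) G] [Group G]
    [ConnectedSpace G] [LieGroup (𝓡 3) ∞ G]
    (gG : SmoothMetric G) (hgG : gG.IsLeftInvariant)
    (e₁ e₂ e₃ : GroupLieAlgebra (𝓡 3) G)
    (he₁₁ : gG.inner 1 e₁ e₁ = 1) (he₂₂ : gG.inner 1 e₂ e₂ = 1) (he₃₃ : gG.inner 1 e₃ e₃ = 1)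
    (he₁₂ : gG.inner 1 e₁ e₂ = 0) (he₁₃ : gG.inner 1 e₁ e₃ = 0) (he₂₃ : gG.inner 1 e₂ e₃ = 0)
    (α β δ : ℝ)
    (hb₁₂ : ⁅e₁, e₂⁆ = α • e₂ + β • e₃)
    (hb₁₃ : ⁅e₁, e₃⁆ = (-β) • e₂ + δ • e₃)
    (hb₂₃ : ⁅e₂, e₃⁆ = 0)
    (hαδ_pos : 0 < α + δ) (hαδ : δ ≤ α)
    (J : Set ℝ) (hJ_open : IsOpen J) (hJ_interval : J.OrdConnected) (hJ_nonempty : J.Nonempty)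
    (f φ : ℝ → ℝ) (hf : ContDiffOn ℝ ∞ f J) (hf_pos : ∀ t ∈ J, 0 < f t)
    (hφ : ContDiffOn ℝ ∞ φ J)
    (a b c : ℝ) (habc : a ^ 2 + b ^ 2 + c ^ 2 = 1) :
    IsHarmonicVectorFieldOn (𝓘(ℝ, ℝ).prod (𝓡 3)) (warpedMetric f gG) (J ×ˢ (Set.univ : Set G))
        (warpedField φ (a • e₁ + b • e₂ + c • e₃)) ↔
      ∃ ε : ℝ,
        (∀ t ∈ J, f t * deriv (deriv f) t + 2 * (deriv f t) ^ 2 = ε) ∧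
        (∀ t ∈ J, deriv (deriv φ) t + 3 * (deriv f t / f t) * deriv φ t
            - 3 * (deriv f t / f t) ^ 2 * φ t = -2 * a * (α + δ) * (deriv f t / f t)) ∧
        ((α = δ ∧ 0 < δ ∧
            ((ε = 2 * α ^ 2 ∧ (a = 1 ∨ a = -1) ∧ b = 0 ∧ c = 0) ∨
             (β = 0 ∧ ε = α ^ 2 ∧
                ((a = 0 ∧ (b = 1 ∨ b = -1) ∧ c = 0) ∨ (a = 0 ∧ b = 0 ∧ (c = 1 ∨ c = -1)))) ∨
             (β = 0 ∧ ε = α ^ 2 + β ^ 2 ∧ a = 0 ∧ b ≠ 0 ∧ c ≠ 0 ∧ b ^ 2 + c ^ 2 = 1))) ∨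
         (((δ < α ∧ 0 < δ) ∨ (0 < α ∧ δ < 0)) ∧
            ((ε = α ^ 2 + δ ^ 2 ∧ a ≠ 0 ∧ a ^ 2 + b ^ 2 + c ^ 2 = 1 ∧
                b * (β ^ 2 - δ ^ 2) = β * (α + δ) * c ∧
                c * (β ^ 2 - α ^ 2) = -β * (α + δ) * b) ∨
             (β = 0 ∧ ε = δ ^ 2 ∧ a = 0 ∧ b = 0 ∧ (c = 1 ∨ c = -1)) ∨
             (β = 0 ∧ ε = α ^ 2 ∧ a = 0 ∧ (b = 1 ∨ b = -1) ∧ c = 0) ∨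
             (β = b * c * (α - δ) ∧ ε = β ^ 2 + b ^ 2 * α ^ 2 + c ^ 2 * δ ^ 2 ∧
                a = 0 ∧ b ≠ 0 ∧ c ≠ 0 ∧ b ^ 2 + c ^ 2 = 1))) ∨
         (δ < α ∧ δ = 0 ∧
            ((β = 0 ∧ ε = 0 ∧
                (∃ c₁ c₂ : ℝ, ∀ t ∈ J, 0 < c₁ * t + c₂ ∧ f t = (c₁ * t + c₂) ^ (1 / 3 : ℝ)) ∧
                a = 0 ∧ b = 0 ∧ (c = 1 ∨ c = -1)) ∨
             (β = 0 ∧ ε = α ^ 2 ∧ a = 0 ∧ (b = 1 ∨ b = -1) ∧ c = 0) ∨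
             (β = b * c * α ∧ ε = β ^ 2 + b ^ 2 * α ^ 2 ∧
                a = 0 ∧ b ≠ 0 ∧ c ≠ 0 ∧ b ^ 2 + c ^ 2 = 1) ∨
             (ε = α ^ 2 ∧ (a = 1 ∨ a = -1) ∧ b = 0 ∧ c = 0) ∨
             (β = 0 ∧ ε = α ^ 2 ∧ a ≠ 0 ∧ c = 0 ∧ a ^ 2 + b ^ 2 = 1)))) := by
  have he : ∀ i j, gG.inner 1 (![e₁, e₂, e₃] i) (![e₁, e₂, e₃] j) = if i = j then 1 else 0 := by
    have he₂₁ : gG.inner 1 e₂ e₁ = 0 := (gG.symm 1 e₂ e₁).trans he₁₂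
    have he₃₁ : gG.inner 1 e₃ e₁ = 0 := (gG.symm 1 e₃ e₁).trans he₁₃
    have he₃₂ : gG.inner 1 e₃ e₂ = 0 := (gG.symm 1 e₃ e₂).trans he₂₃
    intro i j
    fin_cases i <;> fin_cases j <;> simp [*]
  have hf₀ : ∀ t ∈ J, f t ≠ 0 := fun t ht ↦ (hf_pos t ht).ne'
  rw [isHarmonicVectorFieldOn_warpedField_iff hgG he hb₁₂ hb₁₃ hb₂₃ hJ_open hf hf₀ hφ,
    forall_warpedLaplacian_eq_zero_iff hJ_nonempty hf₀ habc]
  -- The equation for f is kept as the hypothesis `hε`: with ε = 0 it yields the cube-root formula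
  -- required as `P`.
  refine exists_congr fun ε ↦ and_congr_right fun hε ↦ and_congr_right fun _ ↦
    isLaplacianEigenvector_iff hαδ_pos hαδ habc fun h0 ↦ ?_
  exact exists_eq_affine_rpow hJ_open hJ_interval hf hf_pos fun t ht ↦ (hε t ht).trans h0
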